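/- There exists a universal constant $c>0$ with the following property. Let $n\ge 1$, let $\Omega\subset\mathbb{R}^n$ be an orthotope, that is, a closed box of positive edge lengths whose edges are parallel to the vectors of some orthonormal basis of $\mathbb{R}^n$, and let $$0=\mu_0(\Omega)<\mu_1(\Omega)\le\mu_2(\Omega)\le\cdots$$ be the Neumann eigenvalues of the Laplacian on (the interior of) $\Omega$, in non-decreasing order and repeated according to multiplicity. Then for all integers $k\ge l\ge 1$ there exist an integer $l'\le l$ and closed convex sets $\Omega_1,\dots,\Omega_{l'}$ with non-empty interior such that $\Omega=\bigcup_{i=1}^{l'}\Omega_i$, $\operatorname{vol}(\Omega_i\cap\Omega_j)=0$ for all $i\ne j$, and $$\operatorname{Diam}\Omega_i\le c\,n^{3/2}\,\frac{k}{l\sqrt{\mu_k(\Omega)}}\qquad\text{for all } i=1,\dots,l'.$$ -/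

import Mathlib

open MeasureTheory
open scoped ContDiff

/-- An orthotope in `ℝⁿ`: a (closed, non-degenerate) box with centre `p`, whose edges are parallel
to the vectors of an arbitrary orthonormal basis `b` and have lengths `2 * a i > 0`. -/
def IsOrthotope {n : ℕ} (Ω : Set (EuclideanSpace ℝ (Fin n))) : Prop :=
  ∃ (b : OrthonormalBasis (Fin n) ℝ (EuclideanSpace ℝ (Fin n)))
    (p : EuclideanSpace ℝ (Fin n)) (a : Fin n → ℝ),
    (∀ i, 0 < a i) ∧ Ω = {x | ∀ i, |inner ℝ (b i) (x - p)| ≤ a i}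

/-- A finite convex partition of a closed domain `Ω`: closed convex subdomains (convex sets with
non-empty interior) that cover `Ω` and overlap pairwise in sets of volume zero. -/
structure IsConvexPartition {n m : ℕ} (Ω : Set (EuclideanSpace ℝ (Fin n)))
    (P : Fin m → Set (EuclideanSpace ℝ (Fin n))) : Prop where
  convex : ∀ i, Convex ℝ (P i)
  closed : ∀ i, IsClosed (P i)
  interior_nonempty : ∀ i, (interior (P i)).Nonempty
  iUnion_eq : ⋃ i, P i = Ω
  volume_inter : ∀ i j, i ≠ j → volume (P i ∩ P j) = 0

/-- `g ∈ L²(U; ℝⁿ)` is the weak gradient of `u ∈ L²(U)` on the open set `U`: integration by parts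
holds against all smooth functions with compact support in `U`, in every direction. So
`u ∈ H¹(U)` if and only if `u` has a weak gradient in this sense. -/
def IsWeakGradient {n : ℕ} (U : Set (EuclideanSpace ℝ (Fin n)))
    (u : Lp ℝ 2 (volume.restrict U))
    (g : Lp (EuclideanSpace ℝ (Fin n)) 2 (volume.restrict U)) : Prop :=
  ∀ φ : EuclideanSpace ℝ (Fin n) → ℝ, ContDiff ℝ ∞ φ → HasCompactSupport φ → tsupport φ ⊆ U →
    ∀ e : EuclideanSpace ℝ (Fin n),
      ∫ x in U, u x * fderiv ℝ φ x e = - ∫ x in U, inner ℝ (g x) e * φ x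

/-- `u ∈ H¹(U)` is a weak solution of `-Δ u = t u` in `U` with the Neumann boundary condition
`∂u/∂ν = 0`: `∫_U ⟨∇u, ∇v⟩ = t ∫_U u v` for all `v ∈ H¹(U)`. (The inner products are those
of `L²(U; ℝⁿ)` and `L²(U)`.) -/
def IsNeumannSolution {n : ℕ} (U : Set (EuclideanSpace ℝ (Fin n))) (t : ℝ)
    (u : Lp ℝ 2 (volume.restrict U)) : Prop :=
  ∃ g : Lp (EuclideanSpace ℝ (Fin n)) 2 (volume.restrict U), IsWeakGradient U u g ∧
    ∀ (v : Lp ℝ 2 (volume.restrict U))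
      (h : Lp (EuclideanSpace ℝ (Fin n)) 2 (volume.restrict U)),
      IsWeakGradient U v h → inner ℝ g h = t * inner ℝ u v

/-- The `k`-th Neumann eigenvalue of the Laplacian on the open set `U`, in non-decreasing order,
repeated according to multiplicity and numbered from `k = 0`: the least `t` such that there are
`k + 1` linearly independent Neumann eigenfunctions with eigenvalues at most `t`. -/
noncomputable def neumannEigenvalue {n : ℕ} (U : Set (EuclideanSpace ℝ (Fin n))) (k : ℕ) : ℝ :=
  sInf {t : ℝ | ∃ f : Fin (k + 1) → Lp ℝ 2 (volume.restrict U),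
    LinearIndependent ℝ f ∧ ∀ i, ∃ s ≤ t, IsNeumannSolution U s (f i)}

/-! Let the box have edges `L i = 2 * a i`. Cutting each edge into `⌈L i / δ⌉₊` equal parts gives
cells of diameter at most `√n * δ`, so the question is which `δ` needs at most `l` cells and how it
compares with `μ_k`. Both answers come from one scale `r`, chosen so that `∏ (1 + ⌊r * L i⌋₊)`
exceeds `k` while the same product at `r / 2` does not.

At scale `r`, the product counts the cosine modes whose frequency on every edge is at most `π r`.
They are orthogonal Neumann eigenfunctions with eigenvalue at most `n (π r)²`, so `√μ_k ≤ √n π r`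
(`neumannEigenvalue_openBox_le`). At scale `r / 2`, the bound by `k` forces the grid with `δ = 4k /
(l r)` to have at most `l` cells (`ceil_prod_le`). Eliminating `r` gives diameter at most `4π n k /
(l √μ_k)`, which is stronger than required.

The full spectrum is not needed, but `μ_k > 0` is. It follows from completeness of the modes
(Stone–Weierstrass): an eigenfunction below the first nonzero mode eigenvalue is a multiple of the
constant.

The analytic core is that modes solve the weak equation against every `v ∈ H¹`, although weak
gradients are tested only on compactly supported functions. `IsWeakGradient.integral_mul_fderiv_eq`
bridges this with cutoffs: a normal derivative vanishing linearly at the faces absorbs the blow-up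
of the cutoff's derivative. -/

/-- The `i`-th coordinate of `x` with respect to the orthonormal basis `b` and the origin `p`. -/
noncomputable def boxCoord {n : ℕ} (b : OrthonormalBasis (Fin n) ℝ (EuclideanSpace ℝ (Fin n)))
    (p : EuclideanSpace ℝ (Fin n)) (i : Fin n) (x : EuclideanSpace ℝ (Fin n)) : ℝ :=
  inner ℝ (b i) (x - p)

/-- The open box with centre `p` and half edge lengths `a`, parallel to the basis `b`. -/
def openBox {n : ℕ} (b : OrthonormalBasis (Fin n) ℝ (EuclideanSpace ℝ (Fin n)))
    (p : EuclideanSpace ℝ (Fin n)) (a : Fin n → ℝ) : Set (EuclideanSpace ℝ (Fin n)) :=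
  {x | ∀ i, |boxCoord b p i x| < a i}

/-- The closed box with centre `p` and half edge lengths `a`, parallel to the basis `b`. -/
def closedBox {n : ℕ} (b : OrthonormalBasis (Fin n) ℝ (EuclideanSpace ℝ (Fin n)))
    (p : EuclideanSpace ℝ (Fin n)) (a : Fin n → ℝ) : Set (EuclideanSpace ℝ (Fin n)) :=
  {x | ∀ i, |boxCoord b p i x| ≤ a i}

/-! ### Boxes in orthonormal coordinates and their grid partitions -/

section Geometry

variable {n : ℕ} (b : OrthonormalBasis (Fin n) ℝ (EuclideanSpace ℝ (Fin n)))
    (p : EuclideanSpace ℝ (Fin n)) (a : Fin n → ℝ)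

lemma contDiff_boxCoord (i : Fin n) {m : WithTop ℕ∞} : ContDiff ℝ m (boxCoord b p i) := by
  unfold boxCoord
  exact contDiff_const.inner ℝ (contDiff_id.sub contDiff_const)

lemma continuous_boxCoord (i : Fin n) : Continuous (boxCoord b p i) :=
  (contDiff_boxCoord b p i (m := 0)).continuous

lemma boxCoord_add_smul (i j : Fin n) (x : EuclideanSpace ℝ (Fin n)) (s : ℝ) :
    boxCoord b p j (x + s • b i) = boxCoord b p j x + if j = i then s else 0 := by
  unfold boxCoord
  rw [add_sub_right_comm, inner_add_right, inner_smul_right,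
    orthonormal_iff_ite.mp b.orthonormal j i]
  simp

lemma boxCoord_sum (c : Fin n → ℝ) (i : Fin n) :
    boxCoord b p i (p + ∑ j, c j • b j) = c i := by
  unfold boxCoord
  rw [add_sub_cancel_left, inner_sum]
  simp [inner_smul_right, orthonormal_iff_ite.mp b.orthonormal]

lemma boxCoord_injective {x y : EuclideanSpace ℝ (Fin n)}
    (h : ∀ i, boxCoord b p i x = boxCoord b p i y) : x = y := by
  apply b.repr.injective
  ext i
  have := h i
  simp only [boxCoord, inner_sub_right] at this
  rw [b.repr_apply_apply, b.repr_apply_apply]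
  linarith

lemma dist_sq_eq_sum_boxCoord (x y : EuclideanSpace ℝ (Fin n)) :
    dist x y ^ 2 = ∑ i, (boxCoord b p i x - boxCoord b p i y) ^ 2 := by
  rw [dist_eq_norm, ← b.sum_sq_norm_inner_right (x - y)]
  refine Finset.sum_congr rfl fun i _ => ?_
  simp only [boxCoord, inner_sub_right, Real.norm_eq_abs, sq_abs]
  ring

lemma boxCoord_combo (i : Fin n) (x y : EuclideanSpace ℝ (Fin n)) {s t : ℝ} (h : s + t = 1) :
    boxCoord b p i (s • x + t • y) = s * boxCoord b p i x + t * boxCoord b p i y := by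
  have : s • x + t • y - p = s • (x - p) + t • (y - p) := by
    rw [smul_sub, smul_sub]
    have : p = s • p + t • p := by rw [← add_smul, h, one_smul]
    nth_rewrite 1 [this]
    abel
  simp only [boxCoord, this, inner_add_right, inner_smul_right]

lemma isOpen_openBox : IsOpen (openBox b p a) := by
  have : openBox b p a = ⋂ i, {x | |boxCoord b p i x| < a i} := by
    ext; simp [openBox]
  rw [this]
  exact isOpen_iInter_of_finite fun i =>
    isOpen_lt (continuous_boxCoord b p i).abs continuous_const

lemma isClosed_closedBox : IsClosed (closedBox b p a) := by
  have : closedBox b p a = ⋂ i, {x | |boxCoord b p i x| ≤ a i} := by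
    ext; simp [closedBox]
  rw [this]
  exact isClosed_iInter fun i =>
    isClosed_le (continuous_boxCoord b p i).abs continuous_const

lemma openBox_subset_closedBox : openBox b p a ⊆ closedBox b p a :=
  fun _ hx i => (hx i).le

lemma isCompact_closedBox : IsCompact (closedBox b p a) := by
  refine Metric.isCompact_of_isClosed_isBounded (isClosed_closedBox b p a) ?_
  refine (Metric.isBounded_iff_subset_closedBall p).2 ⟨√(∑ i, a i ^ 2), fun x hx => ?_⟩
  rw [Metric.mem_closedBall]
  refine Real.le_sqrt_of_sq_le ?_
  rw [dist_sq_eq_sum_boxCoord b p]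
  refine Finset.sum_le_sum fun i _ => ?_
  have h0 : boxCoord b p i p = 0 := by simp [boxCoord]
  rw [h0, sub_zero]
  exact sq_le_sq' (abs_le.1 (hx i)).1 (abs_le.1 (hx i)).2

lemma interior_closedBox : interior (closedBox b p a) = openBox b p a := by
  refine subset_antisymm (fun x hx i => ?_)
    (interior_maximal (openBox_subset_closedBox b p a) (isOpen_openBox b p a))
  have hlim : Filter.Tendsto (fun s : ℝ => x + s • b i) (nhds 0) (nhds x) := by
    have : Continuous (fun s : ℝ => x + s • b i) := by fun_prop
    simpa using this.tendsto 0
  have hev := hlim.eventually (mem_interior_iff_mem_nhds.1 hx)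
  obtain ⟨ε, hε, hb⟩ := Metric.eventually_nhds_iff.1 hev
  have h1 := hb (y := ε / 2) (by rw [Real.dist_eq, sub_zero, abs_of_pos] <;> linarith) i
  have h2 := hb (y := -(ε / 2)) (by
    rw [Real.dist_eq, sub_zero, abs_neg, abs_of_pos] <;> linarith) i
  rw [boxCoord_add_smul, if_pos rfl, abs_le] at h1 h2
  rw [abs_lt]
  constructor <;> linarith

/-- A hyperplane given by a fixed coordinate has measure zero. -/
lemma volume_boxCoord_eq (i : Fin n) (c : ℝ) :
    volume {x : EuclideanSpace ℝ (Fin n) | boxCoord b p i x = c} = 0 := by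
  -- The hyperplane lies in the frontier of this half-space, and frontiers of convex sets are null.
  have hconv : Convex ℝ {x : EuclideanSpace ℝ (Fin n) | boxCoord b p i x ≤ c} := by
    intro x hx y hy s t hs ht hst
    simp only [Set.mem_ofPred_eq] at hx hy ⊢
    rw [boxCoord_combo b p i x y hst]
    have := mul_le_mul_of_nonneg_left hx hs
    have := mul_le_mul_of_nonneg_left hy ht
    have : s * c + t * c = c := by rw [← add_mul, hst, one_mul]
    linarith
  refine measure_mono_null (fun x hx => ?_) (hconv.addHaar_frontier volume)
  simp only [Set.mem_ofPred_eq] at hx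
  refine ⟨subset_closure hx.le, fun hx_int => ?_⟩
  have hlim : Filter.Tendsto (fun s : ℝ => x + s • b i) (nhds 0) (nhds x) := by
    have : Continuous (fun s : ℝ => x + s • b i) := by fun_prop
    simpa using this.tendsto 0
  have hev := hlim.eventually (mem_interior_iff_mem_nhds.1 hx_int)
  obtain ⟨ε, hε, hb⟩ := Metric.eventually_nhds_iff.1 hev
  have h1 := hb (y := ε / 2) (by rw [Real.dist_eq, sub_zero, abs_of_pos] <;> linarith)
  rw [boxCoord_add_smul, if_pos rfl] at h1
  linarith

variable {a}

/-- A box can be cut into `∏ N i` congruent boxes by cutting its `i`-th edge into `N i` parts. -/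
lemma exists_grid_partition (ha : ∀ i, 0 < a i) (N : Fin n → ℕ) (hN : ∀ i, 0 < N i) {δ : ℝ}
    (hδ : ∀ i, 2 * a i ≤ δ * N i) (hδ0 : 0 ≤ δ) :
    ∃ P : Fin (∏ i, N i) → Set (EuclideanSpace ℝ (Fin n)),
      IsConvexPartition (closedBox b p a) P ∧ ∀ j, Metric.diam (P j) ≤ √n * δ := by
  have hN' : ∀ i, (0 : ℝ) < N i := fun i => by exact_mod_cast hN i
  -- The rescaled coordinate runs over `[0, N i]`, so the cells are the unit cubes with integer
  -- corners.
  let Q : (∀ i, Fin (N i)) → Set (EuclideanSpace ℝ (Fin n)) := fun j =>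
    {x | ∀ i, (j i : ℝ) ≤ (boxCoord b p i x + a i) * N i / (2 * a i) ∧
      (boxCoord b p i x + a i) * N i / (2 * a i) ≤ j i + 1}
  have hcont : ∀ i, Continuous fun x => (boxCoord b p i x + a i) * N i / (2 * a i) := fun i =>
    (((continuous_boxCoord b p i).add continuous_const).mul continuous_const).div_const _
  have hclosed : ∀ j, IsClosed (Q j) := fun j => by
    have : Q j = ⋂ i, ({x | (j i : ℝ) ≤ (boxCoord b p i x + a i) * N i / (2 * a i)} ∩
        {x | (boxCoord b p i x + a i) * N i / (2 * a i) ≤ j i + 1}) := by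
      ext; simp [Q]
    rw [this]
    exact isClosed_iInter fun i => (isClosed_le continuous_const (hcont i)).inter
      (isClosed_le (hcont i) continuous_const)
  have hconv : ∀ j, Convex ℝ (Q j) := fun j x hx y hy s t hs ht hst i => by
    have e : (boxCoord b p i (s • x + t • y) + a i) * N i / (2 * a i) =
        s * ((boxCoord b p i x + a i) * N i / (2 * a i)) +
          t * ((boxCoord b p i y + a i) * N i / (2 * a i)) := by
      rw [boxCoord_combo b p i x y hst]
      have : a i = (s + t) * a i := by rw [hst, one_mul]
      nth_rewrite 1 [this]
      ring
    rw [e]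
    have h1 := mul_le_mul_of_nonneg_left (hx i).1 hs
    have h2 := mul_le_mul_of_nonneg_left (hy i).1 ht
    have h3 := mul_le_mul_of_nonneg_left (hx i).2 hs
    have h4 := mul_le_mul_of_nonneg_left (hy i).2 ht
    have h5 : s * (j i : ℝ) + t * j i = j i := by rw [← add_mul, hst, one_mul]
    constructor <;> nlinarith
  have hQ_int : ∀ j, (interior (Q j)).Nonempty := fun j => by
    let O : Set (EuclideanSpace ℝ (Fin n)) :=
      ⋂ i, ({x | (j i : ℝ) < (boxCoord b p i x + a i) * N i / (2 * a i)} ∩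
        {x | (boxCoord b p i x + a i) * N i / (2 * a i) < j i + 1})
    have hO : IsOpen O := isOpen_iInter_of_finite fun i =>
      (isOpen_lt continuous_const (hcont i)).inter (isOpen_lt (hcont i) continuous_const)
    have hOQ : O ⊆ Q j := fun x hx i =>
      ⟨(Set.mem_iInter.1 hx i).1.le, (Set.mem_iInter.1 hx i).2.le⟩
    refine ⟨p + ∑ i, ((j i + 1 / 2) * (2 * a i) / N i - a i) • b i, interior_maximal hOQ hO ?_⟩
    refine Set.mem_iInter.2 fun i => ?_
    have e : (boxCoord b p i (p + ∑ i, ((j i + 1 / 2) * (2 * a i) / N i - a i) • b i) + a i) *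
        N i / (2 * a i) = j i + 1 / 2 := by
      rw [boxCoord_sum b p (fun i => ((j i + 1 / 2) * (2 * a i) / N i - a i))]
      have := (ha i).ne'
      have := (hN' i).ne'
      field_simp
      ring
    simp only [Set.mem_inter_iff, Set.mem_ofPred_eq, e]
    constructor <;> linarith
  have hunion : ⋃ j, Q j = closedBox b p a := by
    ext x
    simp only [Set.mem_iUnion]
    constructor
    · rintro ⟨j, hj⟩ i
      obtain ⟨h1, h2⟩ := hj i
      rw [le_div_iff₀ (by linarith [ha i])] at h1
      rw [div_le_iff₀ (by linarith [ha i])] at h2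
      have h3 : (j i : ℝ) + 1 ≤ N i := by exact_mod_cast (j i).2
      have h0 : (0 : ℝ) ≤ (j i : ℝ) * (2 * a i) := by
        have := ha i
        positivity
      have h4 : 0 ≤ boxCoord b p i x + a i := by
        by_contra hneg
        push Not at hneg
        nlinarith [hN' i]
      have h5 : boxCoord b p i x + a i ≤ 2 * a i := by
        refine le_of_mul_le_mul_right ?_ (hN' i)
        calc _ ≤ _ := h2
          _ ≤ (N i : ℝ) * (2 * a i) := mul_le_mul_of_nonneg_right h3 (by linarith [ha i])
          _ = _ := by ring
      rw [abs_le]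
      constructor <;> linarith
    · intro hx
      let T : Fin n → ℝ := fun i => (boxCoord b p i x + a i) * N i / (2 * a i)
      have hT0 : ∀ i, 0 ≤ T i := fun i =>
        div_nonneg (mul_nonneg (by linarith [(abs_le.1 (hx i)).1]) (hN' i).le)
          (by linarith [ha i])
      have hTN : ∀ i, T i ≤ N i := fun i => by
        rw [div_le_iff₀ (by linarith [ha i])]
        have hle : boxCoord b p i x + a i ≤ 2 * a i := by linarith [(abs_le.1 (hx i)).2]
        have := mul_le_mul_of_nonneg_right hle (hN' i).le
        linarith
      -- The minimum matters only on the far face `T i = N i`, which belongs to the last cell.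
      refine ⟨fun i => ⟨min ⌊T i⌋₊ (N i - 1), by have := hN i; omega⟩, fun i => ?_⟩
      have hfl := Nat.floor_le (hT0 i)
      have hlt := Nat.lt_floor_add_one (T i)
      change ((min ⌊T i⌋₊ (N i - 1) : ℕ) : ℝ) ≤ T i ∧ T i ≤ ((min ⌊T i⌋₊ (N i - 1) : ℕ) : ℝ) + 1
      rcases le_total ⌊T i⌋₊ (N i - 1) with h | h
      · rw [min_eq_left h]
        exact ⟨hfl, hlt.le⟩
      · rw [min_eq_right h]
        have hc : ((N i - 1 : ℕ) : ℝ) ≤ (⌊T i⌋₊ : ℝ) := by exact_mod_cast h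
        have hs : ((N i - 1 : ℕ) : ℝ) + 1 = N i := by
          rw [Nat.cast_sub (hN i)]; simp
        exact ⟨hc.trans hfl, by rw [hs]; exact hTN i⟩
  have hvol : ∀ j j', j ≠ j' → volume (Q j ∩ Q j') = 0 := by
    intro j j' hne
    obtain ⟨i, hi⟩ := Function.ne_iff.1 hne
    -- Cells whose indices differ in direction `i` can meet only in a hyperplane orthogonal to `b
    -- i`.
    have key : ∀ {u v : ∀ i, Fin (N i)} {x}, (u i : ℕ) < v i → x ∈ Q u → x ∈ Q v →
        boxCoord b p i x = ((v i : ℕ) : ℝ) * (2 * a i) / N i - a i := by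
      intro u v x hlt hu hv
      have h1 := (hu i).2
      have h2 := (hv i).1
      have h3 : ((u i : ℕ) : ℝ) + 1 ≤ (v i : ℕ) := by exact_mod_cast hlt
      have h4 : (boxCoord b p i x + a i) * N i / (2 * a i) = (v i : ℕ) :=
        le_antisymm (h1.trans h3) h2
      have := (ha i).ne'
      have := (hN' i).ne'
      field_simp at h4 ⊢
      linarith
    rcases lt_or_gt_of_ne (fun h => hi (Fin.ext h) : (j i : ℕ) ≠ j' i) with h | h
    · exact measure_mono_null (fun x hx => key h hx.1 hx.2) (volume_boxCoord_eq b p i _)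
    · exact measure_mono_null (fun x hx => key h hx.2 hx.1) (volume_boxCoord_eq b p i _)
  have hdiam : ∀ j, Metric.diam (Q j) ≤ √n * δ := fun j => by
    refine Metric.diam_le_of_forall_dist_le (by positivity) fun x hx y hy => ?_
    refine abs_le_of_sq_le_sq' ?_ (by positivity) |>.2
    rw [mul_pow, Real.sq_sqrt (by positivity), dist_sq_eq_sum_boxCoord b p]
    calc _ ≤ ∑ _i : Fin n, δ ^ 2 := Finset.sum_le_sum fun i _ => ?_
      _ = _ := by simp
    obtain ⟨hx1, hx2⟩ := hx i
    obtain ⟨hy1, hy2⟩ := hy i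
    rw [le_div_iff₀ (by linarith [ha i])] at hx1 hy1
    rw [div_le_iff₀ (by linarith [ha i])] at hx2 hy2
    have hd := hδ i
    refine sq_le_sq' ?_ ?_ <;> refine le_of_mul_le_mul_right ?_ (hN' i) <;> linarith
  let e : Fin (∏ i, N i) ≃ (∀ i, Fin (N i)) := finPiFinEquiv.symm
  refine ⟨fun j => Q (e j), ⟨fun j => hconv _, fun j => hclosed _, fun j => hQ_int _, ?_, ?_⟩,
    fun j => hdiam _⟩
  · rw [← hunion]
    exact e.surjective.iUnion_comp Q
  · exact fun i j hij => hvol _ _ fun h => hij (e.injective h)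

end Geometry

/-! ### Choice of the scale and the number of cells -/

section Counting

variable {n : ℕ}

/-- Start at a scale where a single edge already contributes the factor `1 + k`, and halve until the
product first drops to `k` or below. This happens because eventually all floors vanish; `r` is the
last scale before the drop. -/
lemma exists_scale_floor_prod (hn : 1 ≤ n) {L : Fin n → ℝ} (hL : ∀ i, 0 < L i) {k : ℕ}
    (hk : 1 ≤ k) :
    ∃ r : ℝ, 0 < r ∧ k + 1 ≤ ∏ i, (1 + ⌊r * L i⌋₊) ∧ ∏ i, (1 + ⌊r / 2 * L i⌋₊) ≤ k := by
  let i₀ : Fin n := ⟨0, hn⟩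
  set R : ℝ := k / L i₀ with hR
  have hk' : (0 : ℝ) < k := by exact_mod_cast hk
  have hR0 : 0 < R := div_pos hk' (hL i₀)
  have hbig : k + 1 ≤ ∏ i, (1 + ⌊R * L i⌋₊) := by
    have h1 : 1 + ⌊R * L i₀⌋₊ ≤ ∏ i, (1 + ⌊R * L i⌋₊) :=
      Finset.single_le_prod' (f := fun i => 1 + ⌊R * L i⌋₊) (fun i _ => by omega)
        (Finset.mem_univ i₀)
    have h2 : ⌊R * L i₀⌋₊ = k := by
      rw [hR, div_mul_cancel₀ _ (hL i₀).ne', Nat.floor_natCast]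
    omega
  have hex : ∃ j : ℕ, ∏ i, (1 + ⌊R / 2 ^ j * L i⌋₊) ≤ k := by
    obtain ⟨j, hj⟩ := pow_unbounded_of_one_lt (R * ∑ i, L i) (one_lt_two (α := ℝ))
    refine ⟨j, ?_⟩
    rw [Finset.prod_eq_one]
    · exact hk
    intro i _
    have : ⌊R / 2 ^ j * L i⌋₊ = 0 := by
      rw [Nat.floor_eq_zero, div_mul_eq_mul_div, div_lt_one (by positivity)]
      refine lt_of_le_of_lt ?_ hj
      exact mul_le_mul_of_nonneg_left
        (Finset.single_le_sum (fun i _ => (hL i).le) (Finset.mem_univ i)) hR0.le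
    rw [this, add_zero]
  classical
  obtain ⟨m, hm⟩ : ∃ m, Nat.find hex = m + 1 := by
    refine Nat.exists_eq_succ_of_ne_zero fun h0 => ?_
    have := Nat.find_spec hex
    rw [h0, pow_zero, div_one] at this
    omega
  refine ⟨R / 2 ^ m, by positivity, ?_, ?_⟩
  · have := Nat.find_min hex (m := m) (by omega)
    omega
  · have := Nat.find_spec hex
    rw [hm, pow_succ] at this
    rwa [div_div]

/-- Put `x = L i / δ`, so that `r * L i = 2 x k / l`. If `x ≤ 1`, the ceiling is `1`. If `x > 1`,
then `⌈x⌉₊ < 2x`, so the ceiling is smaller than the factor `1 + ⌊r * L i⌋₊` by at least the ratio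
`k / l`. One such edge brings the product from `k` down to `l`; with no such edge there is a single
cell. -/
lemma ceil_prod_le {L : Fin n → ℝ} (hL : ∀ i, 0 < L i) {k l : ℕ} (hl : 1 ≤ l) (hlk : l ≤ k)
    {r : ℝ} (hr : 0 < r) (h : ∏ i, (1 + ⌊r * L i⌋₊) ≤ k) :
    ∏ i, ⌈L i / (2 * k / (l * r))⌉₊ ≤ l := by
  have hl' : (0 : ℝ) < l := by exact_mod_cast hl
  have hlk' : (l : ℝ) ≤ k := by exact_mod_cast hlk
  have hk' : (0 : ℝ) < k := hl'.trans_le hlk'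
  set δ : ℝ := 2 * k / (l * r) with hδ
  have hδ0 : 0 < δ := by positivity
  have hs : δ * r = 2 * (k / l) := by rw [hδ]; field_simp
  have hone : 1 ≤ (k : ℝ) / l := (one_le_div hl').2 hlk'
  have hfac : ∀ i, (⌈L i / δ⌉₊ : ℝ) ≤ ((1 + ⌊r * L i⌋₊ : ℕ) : ℝ) ∧ (1 < L i / δ →
      (⌈L i / δ⌉₊ : ℝ) * (k / l) ≤ ((1 + ⌊r * L i⌋₊ : ℕ) : ℝ)) := by
    intro i
    have hx : 0 < L i / δ := div_pos (hL i) hδ0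
    have hc := Nat.ceil_lt_add_one hx.le
    have hf := Nat.lt_floor_add_one (r * L i)
    have he : r * L i = L i / δ * (2 * (k / l)) := by rw [← hs]; field_simp
    have h2 : 1 < L i / δ →
      (⌈L i / δ⌉₊ : ℝ) * (k / l) ≤ ((1 + ⌊r * L i⌋₊ : ℕ) : ℝ) := by
      intro h1
      push_cast
      have : (⌈L i / δ⌉₊ : ℝ) * (k / l) ≤ (2 * (L i / δ)) * (k / l) :=
        mul_le_mul_of_nonneg_right (by linarith) (by linarith)
      linarith
    refine ⟨?_, h2⟩
    rcases le_or_gt (L i / δ) 1 with h1 | h1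
    · have : ⌈L i / δ⌉₊ ≤ 1 := Nat.ceil_le.2 (by simpa using h1)
      have h3 : ⌈L i / δ⌉₊ ≤ 1 + ⌊r * L i⌋₊ := by omega
      exact_mod_cast h3
    · refine le_trans ?_ (h2 h1)
      exact le_mul_of_one_le_right (Nat.cast_nonneg _) hone
  by_cases hall : ∀ i, L i / δ ≤ 1
  · refine le_trans (Finset.prod_le_one' fun i _ => ?_) hl
    exact Nat.ceil_le.2 (by simpa using hall i)
  push Not at hall
  obtain ⟨i, hi⟩ := hall
  have hk2 : ((∏ i, (1 + ⌊r * L i⌋₊) : ℕ) : ℝ) ≤ k := by exact_mod_cast h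
  have : ((∏ i, ⌈L i / δ⌉₊ : ℕ) : ℝ) * (k / l) ≤ k := by
    refine le_trans ?_ hk2
    rw [Nat.cast_prod, Nat.cast_prod, ← Finset.mul_prod_erase _ _ (Finset.mem_univ i),
      ← Finset.mul_prod_erase (f := fun i => ((1 + ⌊r * L i⌋₊ : ℕ) : ℝ)) _ (Finset.mem_univ i),
      mul_right_comm]
    exact mul_le_mul ((hfac i).2 hi)
      (Finset.prod_le_prod (fun _ _ => Nat.cast_nonneg _) fun j _ => (hfac j).1)
      (Finset.prod_nonneg fun _ _ => Nat.cast_nonneg _) (Nat.cast_nonneg _)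
  rw [mul_div_assoc', div_le_iff₀ hl', mul_comm] at this
  exact_mod_cast le_of_mul_le_mul_left this hk'

end Counting

/-! ### Products of one-variable functions -/

section Products

variable {n : ℕ} (b : OrthonormalBasis (Fin n) ℝ (EuclideanSpace ℝ (Fin n)))
    (p : EuclideanSpace ℝ (Fin n))

/-- The product of functions of the single coordinates. -/
noncomputable def boxProd (f : Fin n → ℝ → ℝ) (x : EuclideanSpace ℝ (Fin n)) : ℝ :=
  ∏ j, f j (boxCoord b p j x)

lemma contDiff_boxProd {f : Fin n → ℝ → ℝ} (hf : ∀ j, ContDiff ℝ ∞ (f j)) :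
    ContDiff ℝ ∞ (boxProd b p f) := by
  unfold boxProd
  exact contDiff_prod fun j _ => (hf j).comp (contDiff_boxCoord b p j)

lemma boxProd_update (f : Fin n → ℝ → ℝ) (i : Fin n) (g : ℝ → ℝ) (x : EuclideanSpace ℝ (Fin n)) :
    boxProd b p (Function.update f i g) x =
      g (boxCoord b p i x) * ∏ j ∈ Finset.univ.erase i, f j (boxCoord b p j x) := by
  unfold boxProd
  rw [← Finset.mul_prod_erase _ _ (Finset.mem_univ i), Function.update_self]
  congr 1
  refine Finset.prod_congr rfl fun j hj => ?_
  rw [Function.update_of_ne (Finset.ne_of_mem_erase hj)]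

/-- Only one factor varies along `b i`, so the derivative is again a `boxProd` and the rule can be
iterated. -/
lemma fderiv_boxProd {f : Fin n → ℝ → ℝ} (hf : ∀ j, ContDiff ℝ ∞ (f j)) (i : Fin n)
    (x : EuclideanSpace ℝ (Fin n)) :
    fderiv ℝ (boxProd b p f) x (b i) =
      boxProd b p (Function.update f i (deriv (f i))) x := by
  have hd : DifferentiableAt ℝ (boxProd b p f) x :=
    ((contDiff_boxProd b p hf).differentiable (by simp)).differentiableAt
  rw [← hd.lineDeriv_eq_fderiv, lineDeriv, boxProd_update]
  have e : (fun t : ℝ => boxProd b p f (x + t • b i)) = fun t =>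
      f i (boxCoord b p i x + t) * ∏ j ∈ Finset.univ.erase i, f j (boxCoord b p j x) := by
    ext t
    unfold boxProd
    rw [← Finset.mul_prod_erase _ _ (Finset.mem_univ i), boxCoord_add_smul, if_pos rfl]
    congr 1
    refine Finset.prod_congr rfl fun j hj => ?_
    rw [boxCoord_add_smul, if_neg (Finset.ne_of_mem_erase hj), add_zero]
  rw [e, deriv_mul_const, deriv_comp_const_add, add_zero]
  exact (((hf i).differentiable (by simp)).comp (by fun_prop)).differentiableAt

end Products

/-! ### Smooth cutoffs on an interval -/

section Cutoff

lemma deriv_smoothTransition_of_one_lt {z : ℝ} (hz : 1 < z) :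
    deriv Real.smoothTransition z = 0 := by
  have : Real.smoothTransition =ᶠ[nhds z] fun _ => 1 := by
    filter_upwards [lt_mem_nhds hz] with y hy using Real.smoothTransition.one_of_one_le hy.le
  rw [this.deriv_eq, deriv_const]

lemma deriv_smoothTransition_of_neg {z : ℝ} (hz : z < 0) :
    deriv Real.smoothTransition z = 0 := by
  have : Real.smoothTransition =ᶠ[nhds z] fun _ => 0 := by
    filter_upwards [gt_mem_nhds hz] with y hy using Real.smoothTransition.zero_of_nonpos hy.le
  rw [this.deriv_eq, deriv_const]

lemma exists_bound_deriv_smoothTransition :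
    ∃ B : ℝ, 0 ≤ B ∧ ∀ z, |deriv Real.smoothTransition z| ≤ B := by
  have hc : Continuous (deriv Real.smoothTransition) :=
    (Real.smoothTransition.contDiff (n := 1)).continuous_deriv le_rfl
  have hs : HasCompactSupport (deriv Real.smoothTransition) :=
    HasCompactSupport.of_support_subset_isCompact (isCompact_Icc (a := (0 : ℝ)) (b := 1))
      fun z hz => by
        by_contra hcon
        rw [Set.mem_Icc, not_and_or, not_le, not_le] at hcon
        exact hz (hcon.elim deriv_smoothTransition_of_neg deriv_smoothTransition_of_one_lt)
  obtain ⟨B, hB⟩ := hs.exists_bound_of_continuous hc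
  exact ⟨B, (norm_nonneg _).trans (hB 0), hB⟩

/-- A smooth function on the line that vanishes near the end points of `[-α, α]` and tends to `1`
in the interior as `k → ∞`. -/
noncomputable def edgeCutoff (α : ℝ) (k : ℕ) (t : ℝ) : ℝ :=
  Real.smoothTransition (k * (1 - (t / α) ^ 2) - 1)

lemma contDiff_edgeCutoff (α : ℝ) (k : ℕ) : ContDiff ℝ ∞ (edgeCutoff α k) := by
  unfold edgeCutoff
  exact Real.smoothTransition.contDiff.comp (by fun_prop)

lemma abs_edgeCutoff_le_one (α : ℝ) (k : ℕ) (t : ℝ) : |edgeCutoff α k t| ≤ 1 := by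
  unfold edgeCutoff
  rw [abs_of_nonneg (Real.smoothTransition.nonneg _)]
  exact Real.smoothTransition.le_one _

lemma deriv_edgeCutoff (α : ℝ) (k : ℕ) (t : ℝ) :
    deriv (edgeCutoff α k) t = deriv Real.smoothTransition (k * (1 - (t / α) ^ 2) - 1) *
      (k * (-(2 * (t / α) * (1 / α)))) := by
  have h1 : HasDerivAt Real.smoothTransition (deriv Real.smoothTransition
      (k * (1 - (t / α) ^ 2) - 1)) (k * (1 - (t / α) ^ 2) - 1) :=
    (((Real.smoothTransition.contDiff (n := 1)).differentiable
      (by simp)).differentiableAt).hasDerivAt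
  have h2 : HasDerivAt (fun t : ℝ => k * (1 - (t / α) ^ 2) - 1)
      (k * (-(2 * (t / α) * (1 / α)))) t := by
    have := ((((hasDerivAt_id t).div_const α).pow 2).const_sub 1).const_mul (k : ℝ)
      |>.sub_const 1
    simpa using this
  exact (h1.comp t h2).deriv

lemma tendsto_mul_one_sub_sq {α t : ℝ} (h : |t| < α) :
    ∀ᶠ k : ℕ in Filter.atTop, 1 < k * (1 - (t / α) ^ 2) - 1 := by
  have hα : 0 < α := (abs_nonneg t).trans_lt h
  have h1 : 0 < 1 - (t / α) ^ 2 := by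
    rw [sub_pos, sq_lt_one_iff_abs_lt_one, abs_div, abs_of_pos hα, div_lt_one hα]
    exact h
  have h2 : Filter.Tendsto (fun k : ℕ => (k : ℝ) * (1 - (t / α) ^ 2)) Filter.atTop Filter.atTop :=
    tendsto_natCast_atTop_atTop.atTop_mul_const h1
  filter_upwards [h2.eventually_gt_atTop 2] with k hk
  linarith

/-- The derivative has size `k` but vanishes once `k * (1 - (t / α) ^ 2) > 2`. The weight therefore
compensates it, uniformly in `k`. -/
lemma abs_deriv_edgeCutoff_mul_le {B : ℝ} (hB : ∀ z, |deriv Real.smoothTransition z| ≤ B)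
    {α t : ℝ} (h : |t| < α) (k : ℕ) :
    |deriv (edgeCutoff α k) t| * (1 - (t / α) ^ 2) ≤ 4 * B / α := by
  have hα : 0 < α := (abs_nonneg t).trans_lt h
  have hB0 : 0 ≤ B := (abs_nonneg _).trans (hB 0)
  have ht : |t / α| ≤ 1 := by
    rw [abs_div, abs_of_pos hα, div_le_one hα]
    exact h.le
  have h1 : 0 ≤ 1 - (t / α) ^ 2 := by
    rw [sub_nonneg, sq_le_one_iff_abs_le_one]
    exact ht
  rw [deriv_edgeCutoff]
  set z : ℝ := k * (1 - (t / α) ^ 2) - 1 with hz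
  have hz1 : 0 ≤ z + 1 := by rw [hz]; simp only [sub_add_cancel]; positivity
  have key : |deriv Real.smoothTransition z| * (z + 1) ≤ 2 * B := by
    rcases le_or_gt z 1 with hle | hlt
    · calc _ ≤ B * 2 := mul_le_mul (hB z) (by linarith) hz1 hB0
        _ = _ := by ring
    · rw [deriv_smoothTransition_of_one_lt hlt, abs_zero, zero_mul]
      positivity
  calc _ = (|deriv Real.smoothTransition z| * (z + 1)) * (|t / α| * (2 / α)) := by
        rw [abs_mul, abs_mul, abs_neg, abs_mul, abs_mul, Nat.abs_cast, abs_of_pos (one_div_pos.2 hα),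
          abs_two, hz]
        ring
    _ ≤ (2 * B) * (1 * (2 / α)) := by
        refine mul_le_mul key (mul_le_mul_of_nonneg_right ht (by positivity)) (by positivity)
          (by positivity)
    _ = _ := by ring

end Cutoff

/-! ### Integration by parts up to the boundary -/

section IntegrationByParts

variable {n : ℕ} (b : OrthonormalBasis (Fin n) ℝ (EuclideanSpace ℝ (Fin n)))
    (p : EuclideanSpace ℝ (Fin n)) (a : Fin n → ℝ)

instance isFiniteMeasure_restrict_openBox :
    IsFiniteMeasure ((volume : Measure (EuclideanSpace ℝ (Fin n))).restrict (openBox b p a)) :=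
  isFiniteMeasure_restrict.2 (((measure_mono (openBox_subset_closedBox b p a)).trans_lt
    (isCompact_closedBox b p a).measure_lt_top).ne)

lemma exists_bound_on_openBox {F : Type*} [NormedAddCommGroup F]
    {f : EuclideanSpace ℝ (Fin n) → F} (hf : Continuous f) :
    ∃ C, 0 ≤ C ∧ ∀ x ∈ openBox b p a, ‖f x‖ ≤ C := by
  obtain ⟨C, hC⟩ := (isCompact_closedBox b p a).exists_bound_of_continuousOn hf.continuousOn
  exact ⟨max C 0, le_max_right _ _, fun x hx =>
    (hC x (openBox_subset_closedBox b p a hx)).trans (le_max_left _ _)⟩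

lemma memLp_openBox {F : Type*} [NormedAddCommGroup F] [SecondCountableTopology F]
    {f : EuclideanSpace ℝ (Fin n) → F} (hf : Continuous f) :
    MemLp f 2 (volume.restrict (openBox b p a)) := by
  obtain ⟨C, -, hC⟩ := exists_bound_on_openBox b p a hf
  exact MemLp.of_bound hf.aestronglyMeasurable C
    ((ae_restrict_iff' (isOpen_openBox b p a).measurableSet).2 (.of_forall hC))

lemma tendsto_setIntegral_mul_of_bounded {u : EuclideanSpace ℝ (Fin n) → ℝ}
    (hu : Integrable u (volume.restrict (openBox b p a)))
    {G : ℕ → EuclideanSpace ℝ (Fin n) → ℝ} {G' : EuclideanSpace ℝ (Fin n) → ℝ} {D : ℝ}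
    (hG : ∀ k, Continuous (G k)) (hb : ∀ k, ∀ x ∈ openBox b p a, |G k x| ≤ D)
    (hlim : ∀ x ∈ openBox b p a, ∀ᶠ k in Filter.atTop, G k x = G' x) :
    Filter.Tendsto (fun k => ∫ x in openBox b p a, u x * G k x) Filter.atTop
      (nhds (∫ x in openBox b p a, u x * G' x)) := by
  have hm := (isOpen_openBox b p a).measurableSet
  refine tendsto_integral_of_dominated_convergence (fun x => |u x| * D)
    (fun k => hu.aestronglyMeasurable.mul (hG k).aestronglyMeasurable) (hu.abs.mul_const D)
    (fun k => (ae_restrict_iff' hm).2 (.of_forall fun x hx => ?_))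
    ((ae_restrict_iff' hm).2 (.of_forall fun x hx => ?_))
  · rw [Real.norm_eq_abs, abs_mul]
    exact mul_le_mul_of_nonneg_left (hb k x hx) (abs_nonneg _)
  · refine tendsto_const_nhds.congr' ?_
    filter_upwards [hlim x hx] with k hk
    rw [hk]

variable {a}

/-- Integration by parts up to the boundary of a box, in the direction of the `i`-th edge, against
a smooth function that vanishes on the two faces orthogonal to that edge. -/
lemma IsWeakGradient.integral_mul_fderiv_eq (ha : ∀ i, 0 < a i)
    {v : Lp ℝ 2 (volume.restrict (openBox b p a))}
    {h : Lp (EuclideanSpace ℝ (Fin n)) 2 (volume.restrict (openBox b p a))}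
    (hvh : IsWeakGradient (openBox b p a) v h) (i : Fin n)
    {F : EuclideanSpace ℝ (Fin n) → ℝ} (hF : ContDiff ℝ ∞ F) {C : ℝ}
    (hC : ∀ x ∈ openBox b p a, |F x| ≤ C * (1 - (boxCoord b p i x / a i) ^ 2)) :
    ∫ x in openBox b p a, v x * fderiv ℝ F x (b i) =
      - ∫ x in openBox b p a, inner ℝ (h x) (b i) * F x := by
  let χ : ℕ → EuclideanSpace ℝ (Fin n) → ℝ := fun k => boxProd b p fun j => edgeCutoff (a j) k
  have hχ : ∀ k, ContDiff ℝ ∞ (χ k) := fun k =>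
    contDiff_boxProd b p fun j => contDiff_edgeCutoff (a j) k
  have hχF : ∀ k, ContDiff ℝ ∞ (fun x => χ k x * F x) := fun k => (hχ k).mul hF
  have hfd : ∀ k x, fderiv ℝ (fun x => χ k x * F x) x (b i) =
      fderiv ℝ (χ k) x (b i) * F x + χ k x * fderiv ℝ F x (b i) := by
    intro k x
    have := fderiv_fun_mul (𝕜 := ℝ) (d := F) (c := χ k)
      (((hχ k).differentiable (by simp)) x) ((hF.differentiable (by simp)) x)
    rw [this]
    simp only [add_apply, smul_apply, smul_eq_mul]
    ring
  have hχ1 : ∀ k x, |χ k x| ≤ 1 := fun k x => by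
    simp only [χ, boxProd, Finset.abs_prod]
    exact Finset.prod_le_one (fun _ _ => abs_nonneg _) fun j _ => abs_edgeCutoff_le_one _ _ _
  have hsupp : ∀ k x, χ k x ≠ 0 → ∀ j, 1 ≤ k * (1 - (boxCoord b p j x / a j) ^ 2) := by
    intro k x hx j
    by_contra hcon
    push Not at hcon
    exact hx (Finset.prod_eq_zero (Finset.mem_univ j)
      (Real.smoothTransition.zero_of_nonpos (by linarith)))
  have hev : ∀ x ∈ openBox b p a, ∀ᶠ k in Filter.atTop,
      χ k x = 1 ∧ fderiv ℝ (χ k) x (b i) = 0 := by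
    intro x hx
    have : ∀ᶠ k : ℕ in Filter.atTop, ∀ j, 1 < k * (1 - (boxCoord b p j x / a j) ^ 2) - 1 :=
      Filter.eventually_all.2 fun j => tendsto_mul_one_sub_sq (hx j)
    filter_upwards [this] with k hk
    refine ⟨Finset.prod_eq_one fun j _ => Real.smoothTransition.one_of_one_le (hk j).le, ?_⟩
    rw [fderiv_boxProd b p (fun j => contDiff_edgeCutoff (a j) k), boxProd_update,
      deriv_edgeCutoff, deriv_smoothTransition_of_one_lt (hk i), zero_mul, zero_mul]
  have hsub : ∀ k, {x | ∀ j, 1 ≤ (k : ℕ) * (1 - (boxCoord b p j x / a j) ^ 2)} ⊆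
      openBox b p a := fun k x hx j => by
    have h1 : 0 < 1 - (boxCoord b p j x / a j) ^ 2 := by
      by_contra hcon
      push Not at hcon
      have := mul_nonpos_of_nonneg_of_nonpos (Nat.cast_nonneg (α := ℝ) k) hcon
      linarith [hx j]
    have h2 : |boxCoord b p j x / a j| < 1 := by
      rw [← sq_lt_one_iff_abs_lt_one]
      linarith
    rwa [abs_div, abs_of_pos (ha j), div_lt_one (ha j)] at h2
  have hclosed : ∀ k, IsClosed {x | ∀ j, 1 ≤ (k : ℕ) * (1 - (boxCoord b p j x / a j) ^ 2)} := by
    intro k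
    have : {x | ∀ j, 1 ≤ (k : ℕ) * (1 - (boxCoord b p j x / a j) ^ 2)} =
        ⋂ j, {x | 1 ≤ (k : ℕ) * (1 - (boxCoord b p j x / a j) ^ 2)} := by
      ext; simp
    rw [this]
    exact isClosed_iInter fun j => isClosed_le continuous_const (continuous_const.mul
      (continuous_const.sub (((continuous_boxCoord b p j).div_const _).pow 2)))
  have hsuppF : ∀ k, Function.support (fun x => χ k x * F x) ⊆
      {x | ∀ j, 1 ≤ (k : ℕ) * (1 - (boxCoord b p j x / a j) ^ 2)} :=
    fun k x hx => hsupp k x (left_ne_zero_of_mul hx)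
  have hts : ∀ k, tsupport (fun x => χ k x * F x) ⊆ openBox b p a := fun k =>
    (closure_minimal (hsuppF k) (hclosed k)).trans (hsub k)
  have hcs : ∀ k, HasCompactSupport (fun x => χ k x * F x) := fun k =>
    HasCompactSupport.of_support_subset_isCompact (isCompact_closedBox b p a)
      ((hsuppF k).trans ((hsub k).trans (openBox_subset_closedBox b p a)))
  have heq := fun k => hvh _ (hχF k) (hcs k) (hts k) (b i)
  have hFc : Continuous fun x => fderiv ℝ F x (b i) :=
    (hF.continuous_fderiv (by simp)).clm_apply continuous_const
  obtain ⟨D, hD0, hD⟩ := exists_bound_on_openBox b p a hFc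
  obtain ⟨D', hD'0, hD'⟩ := exists_bound_on_openBox b p a hF.continuous
  obtain ⟨B, hB0, hB⟩ := exists_bound_deriv_smoothTransition
  have hv : Integrable v (volume.restrict (openBox b p a)) := (Lp.memLp v).integrable one_le_two
  have hh : Integrable (fun x => inner ℝ (h x) (b i)) (volume.restrict (openBox b p a)) :=
    ((Lp.memLp h).integrable one_le_two).inner_const (b i)
  -- Differentiating along `b i` hits only the `i`-th cutoff, so `F` has to vanish only on the two
  -- faces orthogonal to `b i`. There `hC` supplies exactly the weight that keeps the product
  -- bounded in `k`.
  have hlim1 := tendsto_setIntegral_mul_of_bounded b p a hv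
    (G := fun k x => fderiv ℝ (fun x => χ k x * F x) x (b i))
    (G' := fun x => fderiv ℝ F x (b i)) (D := |C| * (4 * B / a i) + D)
    (fun k => ((hχF k).continuous_fderiv (by simp)).clm_apply continuous_const)
    (fun k x hx => by
      rw [hfd]
      have h1 : |χ k x * fderiv ℝ F x (b i)| ≤ D := by
        rw [abs_mul]
        calc _ ≤ 1 * D := mul_le_mul (hχ1 k x) (hD x hx) (abs_nonneg _) zero_le_one
          _ = D := one_mul D
      have h2 : |fderiv ℝ (χ k) x (b i)| ≤ |deriv (edgeCutoff (a i) k) (boxCoord b p i x)| := by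
        rw [fderiv_boxProd b p (fun j => contDiff_edgeCutoff (a j) k), boxProd_update, abs_mul,
          Finset.abs_prod]
        exact mul_le_of_le_one_right (abs_nonneg _)
          (Finset.prod_le_one (fun _ _ => abs_nonneg _) fun j _ => abs_edgeCutoff_le_one _ _ _)
      have hq : 0 ≤ 1 - (boxCoord b p i x / a i) ^ 2 := by
        rw [sub_nonneg, sq_le_one_iff_abs_le_one, abs_div, abs_of_pos (ha i),
          div_le_one (ha i)]
        exact (hx i).le
      have h3 : |fderiv ℝ (χ k) x (b i) * F x| ≤ |C| * (4 * B / a i) := by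
        rw [abs_mul]
        calc _ ≤ |deriv (edgeCutoff (a i) k) (boxCoord b p i x)| *
              (|C| * (1 - (boxCoord b p i x / a i) ^ 2)) :=
              mul_le_mul h2 ((hC x hx).trans (mul_le_mul_of_nonneg_right (le_abs_self C) hq))
                (abs_nonneg _) (abs_nonneg _)
          _ = |C| * (|deriv (edgeCutoff (a i) k) (boxCoord b p i x)| *
              (1 - (boxCoord b p i x / a i) ^ 2)) := by ring
          _ ≤ _ := mul_le_mul_of_nonneg_left (abs_deriv_edgeCutoff_mul_le hB (hx i) k)
              (abs_nonneg _)
      exact (abs_add_le _ _).trans (add_le_add h3 h1))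
    (fun x hx => by
      filter_upwards [hev x hx] with k hk
      rw [hfd, hk.1, hk.2, zero_mul, one_mul, zero_add])
  have hlim2 := tendsto_setIntegral_mul_of_bounded b p a hh
    (G := fun k x => χ k x * F x) (G' := F) (D := D')
    (fun k => (hχF k).continuous)
    (fun k x hx => by
      rw [abs_mul]
      calc _ ≤ 1 * D' := mul_le_mul (hχ1 k x) (hD' x hx) (abs_nonneg _) zero_le_one
        _ = D' := one_mul D')
    (fun x hx => by
      filter_upwards [hev x hx] with k hk
      rw [hk.1, one_mul])
  refine tendsto_nhds_unique hlim1 ?_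
  simp_rw [heq]
  exact hlim2.neg

end IntegrationByParts

/-! ### Smooth functions as elements of the Sobolev space -/

section SmoothFunctions

variable {n : ℕ} (b : OrthonormalBasis (Fin n) ℝ (EuclideanSpace ℝ (Fin n)))
    (p : EuclideanSpace ℝ (Fin n)) (a : Fin n → ℝ)

lemma inner_gradient_apply (F : EuclideanSpace ℝ (Fin n) → ℝ) (x e : EuclideanSpace ℝ (Fin n)) :
    inner ℝ (gradient F x) e = fderiv ℝ F x e := by
  rw [← InnerProductSpace.toDual_apply_apply (𝕜 := ℝ), toDual_gradient]

lemma continuous_gradient {F : EuclideanSpace ℝ (Fin n) → ℝ} (hF : ContDiff ℝ ∞ F) :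
    Continuous (gradient F) :=
  (InnerProductSpace.toDual ℝ _).symm.continuous.comp (hF.continuous_fderiv (by simp))

/-- A smooth function on the whole space, as an element of `L²` of a box. -/
noncomputable def toBoxLp {F : EuclideanSpace ℝ (Fin n) → ℝ} (hF : ContDiff ℝ ∞ F) :
    Lp ℝ 2 (volume.restrict (openBox b p a)) :=
  (memLp_openBox b p a hF.continuous).toLp F

/-- The gradient of a smooth function on the whole space, as an element of `L²` of a box. -/
noncomputable def gradToBoxLp {F : EuclideanSpace ℝ (Fin n) → ℝ} (hF : ContDiff ℝ ∞ F) :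
    Lp (EuclideanSpace ℝ (Fin n)) 2 (volume.restrict (openBox b p a)) :=
  (memLp_openBox b p a (continuous_gradient hF)).toLp (gradient F)

/-- The test function vanishes outside the box, so both integrals extend to the whole space, where
integration by parts has no boundary term. -/
lemma isWeakGradient_toBoxLp {F : EuclideanSpace ℝ (Fin n) → ℝ} (hF : ContDiff ℝ ∞ F) :
    IsWeakGradient (openBox b p a) (toBoxLp b p a hF) (gradToBoxLp b p a hF) := by
  intro φ hφ hcs hts e
  have hout : ∀ G : EuclideanSpace ℝ (Fin n) → ℝ, (∀ x, x ∉ openBox b p a → G x = 0) →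
      ∫ x in openBox b p a, G x = ∫ x, G x := fun G hG =>
    setIntegral_eq_integral_of_forall_compl_eq_zero hG
  have h1 : ∫ x in openBox b p a, (toBoxLp b p a hF) x * fderiv ℝ φ x e =
      ∫ x, F x * fderiv ℝ φ x e := by
    rw [← hout]
    · refine integral_congr_ae ?_
      filter_upwards [(memLp_openBox b p a hF.continuous).coeFn_toLp] with x hx
      rw [toBoxLp, hx]
    · intro x hx
      have : fderiv ℝ φ x = 0 := by
        by_contra hne
        exact hx (hts (support_fderiv_subset ℝ hne))
      rw [this]
      simp
  have h2 : ∫ x in openBox b p a, inner ℝ ((gradToBoxLp b p a hF) x) e * φ x =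
      ∫ x, fderiv ℝ F x e * φ x := by
    rw [← hout (fun x => fderiv ℝ F x e * φ x)]
    · refine integral_congr_ae ?_
      filter_upwards [(memLp_openBox b p a (continuous_gradient hF)).coeFn_toLp] with x hx
      rw [gradToBoxLp, hx, inner_gradient_apply]
    · intro x hx
      rw [image_eq_zero_of_notMem_tsupport (fun h => hx (hts h)), mul_zero]
  rw [h1, h2]
  have hF' : Continuous fun x => fderiv ℝ F x e :=
    (hF.continuous_fderiv (by simp)).clm_apply continuous_const
  have hφ' : Continuous fun x => fderiv ℝ φ x e :=
    (hφ.continuous_fderiv (by simp)).clm_apply continuous_const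
  refine integral_mul_fderiv_eq_neg_fderiv_mul_of_integrable ?_ ?_ ?_ ?_ ?_
  · exact (hF'.mul hφ.continuous).integrable_of_hasCompactSupport hcs.mul_left
  · exact (hF.continuous.mul hφ').integrable_of_hasCompactSupport
      (hcs.fderiv_apply ℝ e).mul_left
  · exact (hF.continuous.mul hφ.continuous).integrable_of_hasCompactSupport hcs.mul_left
  · exact fun x _ => (hF.differentiable (by simp)) x
  · exact fun x _ => (hφ.differentiable (by simp)) x

lemma inner_toBoxLp {F : EuclideanSpace ℝ (Fin n) → ℝ} (hF : ContDiff ℝ ∞ F)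
    (v : Lp ℝ 2 (volume.restrict (openBox b p a))) :
    inner ℝ (toBoxLp b p a hF) v = ∫ x in openBox b p a, v x * F x := by
  rw [L2.inner_def]
  refine integral_congr_ae ?_
  filter_upwards [(memLp_openBox b p a hF.continuous).coeFn_toLp] with x hx
  rw [toBoxLp, hx]
  simp

lemma inner_gradToBoxLp {F : EuclideanSpace ℝ (Fin n) → ℝ} (hF : ContDiff ℝ ∞ F)
    (h : Lp (EuclideanSpace ℝ (Fin n)) 2 (volume.restrict (openBox b p a))) :
    inner ℝ (gradToBoxLp b p a hF) h =
      ∑ i, ∫ x in openBox b p a, inner ℝ (h x) (b i) * fderiv ℝ F x (b i) := by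
  rw [L2.inner_def, ← integral_finsetSum]
  · refine integral_congr_ae ?_
    filter_upwards [(memLp_openBox b p a (continuous_gradient hF)).coeFn_toLp] with x hx
    rw [gradToBoxLp, hx, ← b.sum_inner_mul_inner]
    refine Finset.sum_congr rfl fun i _ => ?_
    rw [inner_gradient_apply, real_inner_comm, mul_comm]
  · intro i _
    obtain ⟨C, -, hC⟩ := exists_bound_on_openBox b p a
      (f := fun x => fderiv ℝ F x (b i))
      ((hF.continuous_fderiv (by simp)).clm_apply continuous_const)
    refine (((Lp.memLp h).integrable one_le_two).inner_const (b i)).mul_bdd (c := C) ?_ ?_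
    · exact ((hF.continuous_fderiv (by simp)).clm_apply continuous_const).aestronglyMeasurable
    · exact (ae_restrict_iff' (isOpen_openBox b p a).measurableSet).2 (.of_forall hC)

end SmoothFunctions

/-! ### Cosine modes as Neumann eigenfunctions -/

section Modes

variable {n : ℕ} (b : OrthonormalBasis (Fin n) ℝ (EuclideanSpace ℝ (Fin n)))
    (p : EuclideanSpace ℝ (Fin n)) (a : Fin n → ℝ)

/-- The frequency of the `m`-th cosine on an edge of half length `α`. -/
noncomputable def edgeFreq (α : ℝ) (m : ℤ) : ℝ := Real.pi * m / (2 * α)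

/-- The `m`-th Neumann eigenfunction of the interval `[-α, α]`. -/
noncomputable def edgeMode (α : ℝ) (m : ℤ) (t : ℝ) : ℝ := Real.cos (edgeFreq α m * (t + α))

/-- The products of cosines that are the Neumann eigenfunctions of a box. -/
noncomputable def boxMode (m : Fin n → ℤ) : EuclideanSpace ℝ (Fin n) → ℝ :=
  boxProd b p fun j => edgeMode (a j) (m j)

/-- The Neumann eigenvalue that belongs to `boxMode b p a m`. -/
noncomputable def boxEigenvalue (m : Fin n → ℤ) : ℝ := ∑ i, edgeFreq (a i) (m i) ^ 2

lemma contDiff_edgeMode (α : ℝ) (m : ℤ) : ContDiff ℝ ∞ (edgeMode α m) := by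
  unfold edgeMode
  fun_prop

lemma deriv_edgeMode (α : ℝ) (m : ℤ) :
    deriv (edgeMode α m) = fun t => -(edgeFreq α m * Real.sin (edgeFreq α m * (t + α))) := by
  ext t
  have h : HasDerivAt (fun t : ℝ => edgeFreq α m * (t + α)) (edgeFreq α m) t := by
    simpa using ((hasDerivAt_id t).add_const α).const_mul (edgeFreq α m)
  rw [show edgeMode α m = fun t => Real.cos (edgeFreq α m * (t + α)) from rfl, h.cos.deriv]
  ring

lemma deriv_deriv_edgeMode (α : ℝ) (m : ℤ) (t : ℝ) :
    deriv (deriv (edgeMode α m)) t = -edgeFreq α m ^ 2 * edgeMode α m t := by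
  have h : HasDerivAt (fun t : ℝ => edgeFreq α m * (t + α)) (edgeFreq α m) t := by
    simpa using ((hasDerivAt_id t).add_const α).const_mul (edgeFreq α m)
  rw [deriv_edgeMode, (h.sin.const_mul (edgeFreq α m)).fun_neg.deriv, edgeMode]
  ring

lemma contDiff_deriv_edgeMode (α : ℝ) (m : ℤ) : ContDiff ℝ ∞ (deriv (edgeMode α m)) := by
  rw [deriv_edgeMode]
  fun_prop

/-- The sine vanishes at both ends because `edgeFreq α m * (2 * α)` is a multiple of `π`. Apply
`|sin y| ≤ |y|` from the nearer end; this yields the weight that integration by parts requires. -/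
lemma abs_deriv_edgeMode_le {α : ℝ} (m : ℤ) {t : ℝ} (ht : |t| < α) :
    |deriv (edgeMode α m) t| ≤ edgeFreq α m ^ 2 * α * (1 - (t / α) ^ 2) := by
  have hα : 0 < α := (abs_nonneg t).trans_lt ht
  obtain ⟨ht1, ht2⟩ := abs_lt.1 ht
  rw [deriv_edgeMode, abs_neg, abs_mul]
  have h1 : |Real.sin (edgeFreq α m * (t + α))| ≤ |edgeFreq α m| * (α + t) := by
    refine Real.abs_sin_le_abs.trans ?_
    rw [abs_mul, abs_of_pos (by linarith : 0 < t + α), add_comm]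
  have h2 : |Real.sin (edgeFreq α m * (t + α))| ≤ |edgeFreq α m| * (α - t) := by
    have e : edgeFreq α m * (t + α) = m * Real.pi - edgeFreq α m * (α - t) := by
      unfold edgeFreq
      field_simp
      ring
    rw [e, Real.sin_int_mul_pi_sub, abs_neg, abs_mul, abs_zpow, abs_neg, abs_one, one_zpow,
      one_mul]
    refine Real.abs_sin_le_abs.trans ?_
    rw [abs_mul, abs_of_pos (by linarith : 0 < α - t)]
  have h3 : |Real.sin (edgeFreq α m * (t + α))| ≤
      |edgeFreq α m| * (α * (1 - (t / α) ^ 2)) := by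
    have e : α * (1 - (t / α) ^ 2) = (α - t) * (α + t) / α := by
      field_simp
      ring
    rw [e]
    rcases le_total 0 t with h0 | h0
    · refine h2.trans (mul_le_mul_of_nonneg_left ?_ (abs_nonneg _))
      rw [le_div_iff₀ hα]
      exact mul_le_mul_of_nonneg_left (by linarith) (by linarith)
    · refine h1.trans (mul_le_mul_of_nonneg_left ?_ (abs_nonneg _))
      rw [le_div_iff₀ hα, mul_comm]
      exact mul_le_mul_of_nonneg_right (by linarith) (by linarith)
  calc _ ≤ |edgeFreq α m| * (|edgeFreq α m| * (α * (1 - (t / α) ^ 2))) :=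
        mul_le_mul_of_nonneg_left h3 (abs_nonneg _)
    _ = |edgeFreq α m| ^ 2 * α * (1 - (t / α) ^ 2) := by ring
    _ = _ := by rw [sq_abs]

lemma contDiff_boxMode (m : Fin n → ℤ) : ContDiff ℝ ∞ (boxMode b p a m) :=
  contDiff_boxProd b p fun j => contDiff_edgeMode (a j) (m j)

variable {a}

/-- The modes satisfy the Neumann eigenvalue equation in every edge direction separately. -/
lemma IsWeakGradient.integral_inner_mul_fderiv_boxMode (ha : ∀ i, 0 < a i)
    {v : Lp ℝ 2 (volume.restrict (openBox b p a))}
    {h : Lp (EuclideanSpace ℝ (Fin n)) 2 (volume.restrict (openBox b p a))}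
    (hvh : IsWeakGradient (openBox b p a) v h) (m : Fin n → ℤ) (i : Fin n) :
    ∫ x in openBox b p a, inner ℝ (h x) (b i) * fderiv ℝ (boxMode b p a m) x (b i) =
      edgeFreq (a i) (m i) ^ 2 * inner ℝ (toBoxLp b p a (contDiff_boxMode b p a m)) v := by
  let f : Fin n → ℝ → ℝ := fun j => edgeMode (a j) (m j)
  let f' : Fin n → ℝ → ℝ := Function.update f i (deriv (f i))
  have hf : ∀ j, ContDiff ℝ ∞ (f j) := fun j => contDiff_edgeMode (a j) (m j)
  have hf' : ∀ j, ContDiff ℝ ∞ (f' j) := fun j => by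
    rcases eq_or_ne j i with rfl | hj
    · simp only [f', Function.update_self]
      exact contDiff_deriv_edgeMode _ _
    · simp only [f', Function.update_of_ne hj]
      exact hf j
  have h1 : ∀ x, fderiv ℝ (boxMode b p a m) x (b i) = boxProd b p f' x := fun x =>
    fderiv_boxProd b p hf i x
  have h2 : ∀ x, fderiv ℝ (boxProd b p f') x (b i) =
      -edgeFreq (a i) (m i) ^ 2 * boxMode b p a m x := fun x => by
    rw [fderiv_boxProd b p hf' i x]
    simp only [f', Function.update_self, Function.update_idem]
    rw [boxProd_update, boxMode, boxProd, ← Finset.mul_prod_erase _ _ (Finset.mem_univ i),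
      deriv_deriv_edgeMode, mul_assoc]
  have h3 : ∀ x ∈ openBox b p a, |boxProd b p f' x| ≤
      edgeFreq (a i) (m i) ^ 2 * a i * (1 - (boxCoord b p i x / a i) ^ 2) := fun x hx => by
    refine le_trans ?_ (abs_deriv_edgeMode_le (m i) (hx i))
    rw [boxProd_update, abs_mul, Finset.abs_prod]
    exact mul_le_of_le_one_right (abs_nonneg _)
      (Finset.prod_le_one (fun _ _ => abs_nonneg _) fun j _ => Real.abs_cos_le_one _)
  have key := hvh.integral_mul_fderiv_eq b p ha i (contDiff_boxProd b p hf') h3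
  simp_rw [h1]
  rw [inner_toBoxLp, ← integral_const_mul, ← neg_inj, ← key, ← integral_neg]
  refine integral_congr_ae (.of_forall fun x => ?_)
  simp only [h2]
  ring

lemma IsWeakGradient.inner_gradToBoxLp_boxMode (ha : ∀ i, 0 < a i)
    {v : Lp ℝ 2 (volume.restrict (openBox b p a))}
    {h : Lp (EuclideanSpace ℝ (Fin n)) 2 (volume.restrict (openBox b p a))}
    (hvh : IsWeakGradient (openBox b p a) v h) (m : Fin n → ℤ) :
    inner ℝ (gradToBoxLp b p a (contDiff_boxMode b p a m)) h =
      boxEigenvalue a m * inner ℝ (toBoxLp b p a (contDiff_boxMode b p a m)) v := by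
  rw [inner_gradToBoxLp, boxEigenvalue, Finset.sum_mul]
  exact Finset.sum_congr rfl fun i _ => hvh.integral_inner_mul_fderiv_boxMode b p ha m i

lemma isNeumannSolution_boxMode (ha : ∀ i, 0 < a i) (m : Fin n → ℤ) :
    IsNeumannSolution (openBox b p a) (boxEigenvalue a m)
      (toBoxLp b p a (contDiff_boxMode b p a m)) :=
  ⟨_, isWeakGradient_toBoxLp b p a (contDiff_boxMode b p a m),
    fun _ _ hvh => hvh.inner_gradToBoxLp_boxMode b p ha m⟩

/-- Evaluate the integral of the product of the two `i`-th partial derivatives in two ways. Working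
in a single direction separates modes even when their total eigenvalues coincide. -/
lemma inner_boxMode_eq_zero (ha : ∀ i, 0 < a i) {m m' : Fin n → ℤ} {i : Fin n}
    (hi : edgeFreq (a i) (m i) ^ 2 ≠ edgeFreq (a i) (m' i) ^ 2) :
    inner ℝ (toBoxLp b p a (contDiff_boxMode b p a m))
      (toBoxLp b p a (contDiff_boxMode b p a m')) = 0 := by
  have h1 := (isWeakGradient_toBoxLp b p a
    (contDiff_boxMode b p a m')).integral_inner_mul_fderiv_boxMode b p ha m i
  have h2 := (isWeakGradient_toBoxLp b p a
    (contDiff_boxMode b p a m)).integral_inner_mul_fderiv_boxMode b p ha m' i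
  have e : ∫ x in openBox b p a, inner ℝ (gradToBoxLp b p a (contDiff_boxMode b p a m') x) (b i) *
      fderiv ℝ (boxMode b p a m) x (b i) =
      ∫ x in openBox b p a, inner ℝ (gradToBoxLp b p a (contDiff_boxMode b p a m) x) (b i) *
      fderiv ℝ (boxMode b p a m') x (b i) := by
    refine integral_congr_ae ?_
    filter_upwards [(memLp_openBox b p a
      (continuous_gradient (contDiff_boxMode b p a m))).coeFn_toLp, (memLp_openBox b p a
      (continuous_gradient (contDiff_boxMode b p a m'))).coeFn_toLp] with x hx hx'
    rw [gradToBoxLp, gradToBoxLp, hx, hx', inner_gradient_apply, inner_gradient_apply, mul_comm]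
  rw [real_inner_comm] at h2
  rw [h1, h2, ← sub_eq_zero, ← sub_mul] at e
  exact (mul_eq_zero.1 e).resolve_left (sub_ne_zero.2 hi)

/-- A mode is continuous and equals `1` at the corner with all coordinates `-a j`, which is a limit
of points of the open box. -/
lemma toBoxLp_boxMode_ne_zero (ha : ∀ i, 0 < a i) (m : Fin n → ℤ) :
    toBoxLp b p a (contDiff_boxMode b p a m) ≠ 0 := by
  intro h0
  have hae : boxMode b p a m =ᵐ[volume.restrict (openBox b p a)] fun _ => 0 := by
    have h1 := (memLp_openBox b p a (contDiff_boxMode b p a m).continuous).coeFn_toLp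
    have h2 := Lp.coeFn_zero ℝ 2 (volume.restrict (openBox b p a))
    rw [← h0] at h2
    exact h1.symm.trans h2
  have hU := Measure.eqOn_open_of_ae_eq hae (isOpen_openBox b p a)
    (contDiff_boxMode b p a m).continuous.continuousOn continuousOn_const
  let γ : ℝ → EuclideanSpace ℝ (Fin n) := fun s => p + ∑ j, (s * a j) • b j
  have hγ : Continuous γ := by fun_prop
  have hlim : Filter.Tendsto (fun s => boxMode b p a m (γ s)) (nhdsWithin (-1) (Set.Ioi (-1)))
      (nhds (boxMode b p a m (γ (-1)))) :=
    (((contDiff_boxMode b p a m).continuous.comp hγ).tendsto (-1)).mono_left nhdsWithin_le_nhds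
  have hone : boxMode b p a m (γ (-1)) = 1 := by
    rw [boxMode, boxProd]
    refine Finset.prod_eq_one fun j _ => ?_
    rw [boxCoord_sum b p (fun j => -1 * a j), edgeMode]
    simp
  have hzero : ∀ᶠ s in nhdsWithin (-1 : ℝ) (Set.Ioi (-1)), boxMode b p a m (γ s) = 0 := by
    filter_upwards [Ioo_mem_nhdsGT (show (-1 : ℝ) < 1 by norm_num)] with s hs
    refine hU fun j => ?_
    rw [boxCoord_sum b p (fun j => s * a j), abs_mul, abs_of_pos (ha j)]
    exact mul_lt_of_lt_one_left (ha j) (abs_lt.2 hs)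
  rw [hone] at hlim
  have := tendsto_nhds_unique hlim ((Filter.tendsto_congr' hzero).2 tendsto_const_nhds)
  exact one_ne_zero this

end Modes

/-! ### Completeness of the modes -/

section Completeness

variable {n : ℕ} (b : OrthonormalBasis (Fin n) ℝ (EuclideanSpace ℝ (Fin n)))
    (p : EuclideanSpace ℝ (Fin n)) {a : Fin n → ℝ}

/-- Product-to-sum formula. Integer indices keep `m - 1` in the family, so `m = 0` is no exception.
-/
lemma edgeMode_one_mul (α : ℝ) (m : ℤ) (t : ℝ) :
    edgeMode α 1 t * edgeMode α m t =
      (1 / 2) * edgeMode α (m + 1) t + (1 / 2) * edgeMode α (m - 1) t := by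
  have h1 : edgeFreq α (m + 1) * (t + α) = edgeFreq α m * (t + α) + edgeFreq α 1 * (t + α) := by
    simp only [edgeFreq]; push_cast; ring
  have h2 : edgeFreq α (m - 1) * (t + α) = edgeFreq α m * (t + α) - edgeFreq α 1 * (t + α) := by
    simp only [edgeFreq]; push_cast; ring
  simp only [edgeMode, h1, h2, Real.cos_add, Real.cos_sub]
  ring

lemma boxMode_update (m : Fin n → ℤ) (i : Fin n) (k : ℤ) (x : EuclideanSpace ℝ (Fin n)) :
    boxMode b p a (Function.update m i k) x = edgeMode (a i) k (boxCoord b p i x) *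
      ∏ j ∈ Finset.univ.erase i, edgeMode (a j) (m j) (boxCoord b p j x) := by
  unfold boxMode boxProd
  rw [← Finset.mul_prod_erase _ _ (Finset.mem_univ i)]
  simp only [Function.update_self]
  congr 1
  refine Finset.prod_congr rfl fun j hj => ?_
  rw [Function.update_of_ne (Finset.ne_of_mem_erase hj)]

lemma edgeMode_one_mul_boxMode (m : Fin n → ℤ) (i : Fin n) (x : EuclideanSpace ℝ (Fin n)) :
    edgeMode (a i) 1 (boxCoord b p i x) * boxMode b p a m x =
      (1 / 2) * boxMode b p a (Function.update m i (m i + 1)) x +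
        (1 / 2) * boxMode b p a (Function.update m i (m i - 1)) x := by
  have h := boxMode_update b p (a := a) m i (m i) x
  rw [Function.update_eq_self] at h
  rw [h, boxMode_update, boxMode_update, ← mul_assoc, edgeMode_one_mul]
  ring

lemma edgeMode_one_injOn {α : ℝ} (hα : 0 < α) : Set.InjOn (edgeMode α 1) {t | |t| ≤ α} := by
  have hmem : ∀ t, |t| ≤ α → edgeFreq α 1 * (t + α) ∈ Set.Icc 0 Real.pi := by
    intro t ht
    obtain ⟨h1, h2⟩ := abs_le.1 ht
    have e : edgeFreq α 1 * (t + α) = Real.pi * ((t + α) / (2 * α)) := by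
      simp only [edgeFreq]; push_cast; ring
    rw [e]
    have h3 : 0 ≤ (t + α) / (2 * α) := div_nonneg (by linarith) (by linarith)
    have h4 : (t + α) / (2 * α) ≤ 1 := (div_le_one (by linarith)).2 (by linarith)
    exact ⟨mul_nonneg Real.pi_pos.le h3, mul_le_of_le_one_right Real.pi_pos.le h4⟩
  intro s hs t ht hst
  have h1 := Real.injOn_cos (hmem s hs) (hmem t ht) hst
  have h2 : edgeFreq α 1 ≠ 0 := by
    simp only [edgeFreq]
    have := Real.pi_pos
    positivity
  have h3 := mul_left_cancel₀ h2 h1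
  linarith

/-- The span of the modes is dense: on the closed box, every continuous function is a uniform limit
of linear combinations of modes. -/
lemma exists_mem_span_boxMode_near (ha : ∀ i, 0 < a i) {φ : EuclideanSpace ℝ (Fin n) → ℝ}
    (hφ : Continuous φ) {ε : ℝ} (hε : 0 < ε) :
    ∃ H ∈ Submodule.span ℝ (Set.range (boxMode b p a)), ∀ x ∈ closedBox b p a,
      |H x - φ x| < ε := by
  set S := Submodule.span ℝ (Set.range (boxMode b p a)) with hS
  have hmul : ∀ i, ∀ G ∈ S, (fun x => edgeMode (a i) 1 (boxCoord b p i x) * G x) ∈ S := by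
    intro i G hG
    induction hG using Submodule.span_induction with
    | mem G hG =>
      obtain ⟨m, rfl⟩ := hG
      have e : (fun x => edgeMode (a i) 1 (boxCoord b p i x) * boxMode b p a m x) =
          (1 / 2 : ℝ) • boxMode b p a (Function.update m i (m i + 1)) +
            (1 / 2 : ℝ) • boxMode b p a (Function.update m i (m i - 1)) := by
        ext x
        simp only [Pi.add_apply, Pi.smul_apply, smul_eq_mul]
        exact edgeMode_one_mul_boxMode b p m i x
      rw [e]
      exact S.add_mem (S.smul_mem _ (Submodule.subset_span ⟨_, rfl⟩))
        (S.smul_mem _ (Submodule.subset_span ⟨_, rfl⟩))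
    | zero =>
      simp only [Pi.zero_apply, mul_zero]
      exact S.zero_mem
    | add G G' _ _ h h' =>
      convert S.add_mem h h' using 1
      ext x
      simp only [Pi.add_apply]
      ring
    | smul c G _ h =>
      convert S.smul_mem c h using 1
      ext x
      simp only [Pi.smul_apply, smul_eq_mul]
      ring
  have : CompactSpace (closedBox b p a) := isCompact_iff_compactSpace.1 (isCompact_closedBox b p a)
  let c : Fin n → C(closedBox b p a, ℝ) := fun i =>
    ⟨fun x => edgeMode (a i) 1 (boxCoord b p i x), ((contDiff_edgeMode (a i) 1).continuous.comp
      (continuous_boxCoord b p i)).comp continuous_subtype_val⟩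
  -- The algebra generated by the first cosines maps the span into itself. Acting on the constant
  -- mode, it is therefore contained in the span, restricted to the closed box.
  have hadj : ∀ F ∈ Algebra.adjoin ℝ (Set.range c), ∀ G ∈ S, ∃ H ∈ S,
      ∀ x : closedBox b p a, F x * G x = H x := by
    intro F hF
    induction hF using Algebra.adjoin_induction with
    | mem F hF =>
      obtain ⟨i, rfl⟩ := hF
      exact fun G hG => ⟨_, hmul i G hG, fun x => rfl⟩
    | algebraMap r =>
      refine fun G hG => ⟨r • G, S.smul_mem r hG, fun x => ?_⟩
      simp
    | add F F' _ _ h h' =>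
      intro G hG
      obtain ⟨H, hH, e⟩ := h G hG
      obtain ⟨H', hH', e'⟩ := h' G hG
      refine ⟨H + H', S.add_mem hH hH', fun x => ?_⟩
      rw [ContinuousMap.add_apply, add_mul, e, e', Pi.add_apply]
    | mul F F' _ _ h h' =>
      intro G hG
      obtain ⟨H', hH', e'⟩ := h' G hG
      obtain ⟨H, hH, e⟩ := h H' hH'
      refine ⟨H, hH, fun x => ?_⟩
      rw [ContinuousMap.mul_apply, mul_assoc, e', e]
  have hsep : (Algebra.adjoin ℝ (Set.range c)).SeparatesPoints := by
    intro x y hxy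
    have hne : ∃ i, boxCoord b p i x ≠ boxCoord b p i y := by
      by_contra hcon
      push Not at hcon
      exact hxy (Subtype.ext (boxCoord_injective b p hcon))
    obtain ⟨i, hi⟩ := hne
    refine ⟨c i, ⟨c i, Algebra.subset_adjoin ⟨i, rfl⟩, rfl⟩, fun heq => hi ?_⟩
    exact edgeMode_one_injOn (ha i) (x.2 i) (y.2 i) heq
  obtain ⟨g, hg⟩ := ContinuousMap.exists_mem_subalgebra_near_continuous_of_separatesPoints _ hsep
    (fun x : closedBox b p a => φ x) (hφ.comp continuous_subtype_val) ε hε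
  have hone : (fun _ => 1 : EuclideanSpace ℝ (Fin n) → ℝ) ∈ S := by
    refine Submodule.subset_span ⟨0, ?_⟩
    ext x
    rw [boxMode, boxProd]
    refine Finset.prod_eq_one fun j _ => ?_
    simp [edgeMode, edgeFreq]
  obtain ⟨H, hH, e⟩ := hadj g g.2 _ hone
  refine ⟨H, hH, fun x hx => ?_⟩
  rw [← e ⟨x, hx⟩, mul_one]
  exact hg ⟨x, hx⟩

/-- The modes are complete in `L²` of the box. -/
lemma eq_zero_of_inner_boxMode_eq_zero (ha : ∀ i, 0 < a i)
    {u : Lp ℝ 2 (volume.restrict (openBox b p a))}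
    (hu : ∀ m, inner ℝ (toBoxLp b p a (contDiff_boxMode b p a m)) u = 0) : u = 0 := by
  have hu_int : Integrable u (volume.restrict (openBox b p a)) :=
    (Lp.memLp u).integrable one_le_two
  have hmulint : ∀ {G : EuclideanSpace ℝ (Fin n) → ℝ}, Continuous G →
      Integrable (fun x => u x * G x) (volume.restrict (openBox b p a)) := by
    intro G hG
    obtain ⟨C, -, hC⟩ := exists_bound_on_openBox b p a hG
    exact hu_int.mul_bdd (c := C) hG.aestronglyMeasurable
      ((ae_restrict_iff' (isOpen_openBox b p a).measurableSet).2 (.of_forall hC))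
  have hspan : ∀ G ∈ Submodule.span ℝ (Set.range (boxMode b p a)),
      Continuous G ∧ ∫ x in openBox b p a, u x * G x = 0 := by
    intro G hG
    induction hG using Submodule.span_induction with
    | mem G hG =>
      obtain ⟨m, rfl⟩ := hG
      exact ⟨(contDiff_boxMode b p a m).continuous, by
        rw [← inner_toBoxLp b p a (contDiff_boxMode b p a m), hu m]⟩
    | zero => exact ⟨continuous_zero, by simp⟩
    | add G G' _ _ h h' =>
      refine ⟨h.1.add h'.1, ?_⟩
      simp only [Pi.add_apply, mul_add]
      rw [integral_add (hmulint h.1) (hmulint h'.1), h.2, h'.2, add_zero]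
    | smul c G _ h =>
      refine ⟨h.1.const_smul c, ?_⟩
      simp only [Pi.smul_apply, smul_eq_mul, mul_left_comm _ c]
      rw [integral_const_mul, h.2, mul_zero]
  have hzero : ∀ φ : EuclideanSpace ℝ (Fin n) → ℝ, Continuous φ →
      ∫ x in openBox b p a, u x * φ x = 0 := by
    intro φ hφ
    by_contra hne
    set I := ∫ x in openBox b p a, |u x| with hI
    have hI0 : 0 ≤ I := integral_nonneg fun x => abs_nonneg _
    have hpos : 0 < |∫ x in openBox b p a, u x * φ x| := abs_pos.2 hne
    -- This tolerance makes the error at most `I / (I + 1)` times the integral, a contradiction; the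
    -- `+ 1` covers `I = 0`.
    obtain ⟨H, hH, hnear⟩ := exists_mem_span_boxMode_near b p ha hφ
      (div_pos hpos (by linarith : 0 < I + 1))
    obtain ⟨hHc, hH0⟩ := hspan H hH
    have e : ∫ x in openBox b p a, u x * φ x = ∫ x in openBox b p a, u x * (φ x - H x) := by
      simp only [mul_sub]
      rw [integral_sub (hmulint hφ) (hmulint hHc), hH0, sub_zero]
    have hle : |∫ x in openBox b p a, u x * φ x| ≤
        I * (|∫ x in openBox b p a, u x * φ x| / (I + 1)) := by
      suffices hnorm : |∫ x in openBox b p a, u x * (φ x - H x)| ≤ ∫ x in openBox b p a,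
          |u x| * (|∫ x in openBox b p a, u x * φ x| / (I + 1)) by
        rwa [← e, integral_mul_const] at hnorm
      refine norm_integral_le_of_norm_le (f := fun x => u x * (φ x - H x)) (hu_int.abs.mul_const _)
        ((ae_restrict_iff' (isOpen_openBox b p a).measurableSet).2 (.of_forall fun x hx => ?_))
      rw [Real.norm_eq_abs, abs_mul, abs_sub_comm]
      exact mul_le_mul_of_nonneg_left (hnear x (openBox_subset_closedBox b p a hx)).le
        (abs_nonneg _)
    rw [mul_div_assoc', le_div_iff₀ (by linarith)] at hle
    nlinarith
  have hae := ae_eq_zero_of_integral_contDiff_smul_eq_zero hu_int.locallyIntegrable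
    fun g hg _ => by
      simp only [smul_eq_mul, mul_comm (g _)]
      exact hzero g hg.continuous
  exact (Lp.eq_zero_iff_ae_eq_zero).2 hae

end Completeness

/-! ### Bounds for the Neumann eigenvalues -/

section Eigenvalues

variable {n : ℕ} (b : OrthonormalBasis (Fin n) ℝ (EuclideanSpace ℝ (Fin n)))
    (p : EuclideanSpace ℝ (Fin n)) {a : Fin n → ℝ}

/-- Test the equation of `u` with the mode and that of the mode with `u`; the Dirichlet form is
symmetric. -/
lemma IsNeumannSolution.inner_boxMode_eq_zero (ha : ∀ i, 0 < a i) {s : ℝ}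
    {u : Lp ℝ 2 (volume.restrict (openBox b p a))}
    (hu : IsNeumannSolution (openBox b p a) s u) {m : Fin n → ℤ} (hm : s ≠ boxEigenvalue a m) :
    inner ℝ (toBoxLp b p a (contDiff_boxMode b p a m)) u = 0 := by
  obtain ⟨g, hg, H⟩ := hu
  have h1 := H _ _ (isWeakGradient_toBoxLp b p a (contDiff_boxMode b p a m))
  have h2 := hg.inner_gradToBoxLp_boxMode b p ha m
  rw [real_inner_comm, h2, real_inner_comm, ← sub_eq_zero, ← sub_mul] at h1
  rw [real_inner_comm]
  exact (mul_eq_zero.1 h1).resolve_left (sub_ne_zero.2 hm.symm)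

lemma exists_pos_le_boxEigenvalue (ha : ∀ i, 0 < a i) :
    ∃ t > 0, ∀ m : Fin n → ℤ, m ≠ 0 → t ≤ boxEigenvalue a m := by
  set M := 1 + ∑ i, a i with hM
  have hM0 : 0 < M := add_pos_of_pos_of_nonneg one_pos (Finset.sum_nonneg fun i _ => (ha i).le)
  have hpi := Real.pi_pos
  refine ⟨(Real.pi / (2 * M)) ^ 2, by positivity, fun m hm => ?_⟩
  obtain ⟨i, hi⟩ := Function.ne_iff.1 hm
  refine le_trans ?_ (Finset.single_le_sum (f := fun i => edgeFreq (a i) (m i) ^ 2)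
    (fun i _ => sq_nonneg _) (Finset.mem_univ i))
  have haM : a i ≤ M := by
    have := Finset.single_le_sum (fun i _ => (ha i).le) (Finset.mem_univ i)
    linarith
  have h1 : (1 : ℝ) ≤ |(m i : ℝ)| := by
    rw [← Int.cast_abs]
    exact_mod_cast Int.one_le_abs hi
  simp only [edgeFreq]
  rw [← sq_abs (Real.pi * (m i : ℝ) / _), abs_div, abs_mul, abs_of_pos hpi,
    abs_of_pos (mul_pos two_pos (ha i))]
  refine pow_le_pow_left₀ (by positivity) ?_ 2
  exact div_le_div₀ (by positivity) (le_mul_of_one_le_right hpi.le h1)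
    (mul_pos two_pos (ha i)) (by linarith)

/-- Below a positive threshold there are no two linearly independent Neumann eigenfunctions. -/
lemma exists_pos_le_of_linearIndependent (ha : ∀ i, 0 < a i) :
    ∃ t₀ > 0, ∀ k : ℕ, 1 ≤ k → ∀ t : ℝ,
      (∃ f : Fin (k + 1) → Lp ℝ 2 (volume.restrict (openBox b p a)), LinearIndependent ℝ f ∧
        ∀ i, ∃ s ≤ t, IsNeumannSolution (openBox b p a) s (f i)) → t₀ ≤ t := by
  obtain ⟨t₀, ht₀, hlow⟩ := exists_pos_le_boxEigenvalue ha
  refine ⟨t₀, ht₀, fun k hk t ⟨f, hf, hsol⟩ => ?_⟩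
  by_contra hlt
  push Not at hlt
  let w := fun m => toBoxLp b p a (contDiff_boxMode b p a m)
  have horth : ∀ i, ∀ m, m ≠ 0 → inner ℝ (w m) (f i) = 0 := by
    intro i m hm
    obtain ⟨s, hst, hs⟩ := hsol i
    exact hs.inner_boxMode_eq_zero b p ha (by linarith [hlow m hm])
  let i₀ : Fin (k + 1) := ⟨0, by omega⟩
  let i₁ : Fin (k + 1) := ⟨1, by omega⟩
  have hne : i₀ ≠ i₁ := by simp [i₀, i₁]
  -- Both functions are orthogonal to every nonconstant mode. This combination is also orthogonal to
  -- the constant one, so completeness makes it zero.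
  have hcomb : inner ℝ (w 0) (f i₁) • f i₀ - inner ℝ (w 0) (f i₀) • f i₁ = 0 := by
    refine eq_zero_of_inner_boxMode_eq_zero b p ha fun m => ?_
    change inner ℝ (w m) _ = 0
    rw [inner_sub_right, inner_smul_right, inner_smul_right]
    rcases eq_or_ne m 0 with rfl | hm
    · ring
    · rw [horth _ m hm, horth _ m hm]
      simp
  have hc0 : inner ℝ (w 0) (f i₀) ≠ 0 := by
    intro h0
    refine hf.ne_zero i₀ (eq_zero_of_inner_boxMode_eq_zero b p ha fun m => ?_)
    rcases eq_or_ne m 0 with rfl | hm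
    · exact h0
    · exact horth _ m hm
  have hpair := (LinearIndependent.pair_iff.1
    (hf.comp ![i₀, i₁] (by
      intro x y hxy
      fin_cases x <;> fin_cases y <;> simp_all) |> fun h => by
        convert h using 1
        ext x
        fin_cases x <;> rfl : LinearIndependent ℝ ![f i₀, f i₁]))
  have := (hpair (inner ℝ (w 0) (f i₁)) (-inner ℝ (w 0) (f i₀)) (by
    rw [neg_smul, ← sub_eq_add_neg, hcomb])).2
  exact hc0 (neg_eq_zero.1 this)

/-- Take the modes with `0 ≤ m i ≤ r * (2 * a i)`: each edge frequency is at most `π r`, and `1 + ⌊r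
* (2 * a i)⌋₊` counts the choices on edge `i`, zero included. -/
lemma exists_linearIndependent_boxMode (ha : ∀ i, 0 < a i) {k : ℕ} {r : ℝ} (hr : 0 < r)
    (hk : k + 1 ≤ ∏ i, (1 + ⌊r * (2 * a i)⌋₊)) :
    ∃ f : Fin (k + 1) → Lp ℝ 2 (volume.restrict (openBox b p a)), LinearIndependent ℝ f ∧
        ∀ i, ∃ s ≤ n * (Real.pi * r) ^ 2, IsNeumannSolution (openBox b p a) s (f i) := by
  have hpi := Real.pi_pos
  let e : Fin (k + 1) → ∀ i, Fin (1 + ⌊r * (2 * a i)⌋₊) := fun q =>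
    finPiFinEquiv.symm (Fin.castLE hk q)
  have he : Function.Injective e := finPiFinEquiv.symm.injective.comp (Fin.castLE_injective hk)
  let m : Fin (k + 1) → Fin n → ℤ := fun q i => ((e q i : ℕ) : ℤ)
  have hfreq : ∀ q i, edgeFreq (a i) (m q i) = Real.pi / (2 * a i) * (e q i : ℕ) := fun q i => by
    simp only [edgeFreq, m]
    push_cast
    ring
  refine ⟨fun q => toBoxLp b p a (contDiff_boxMode b p a (m q)),
    linearIndependent_of_ne_zero_of_inner_eq_zero
      (fun q => toBoxLp_boxMode_ne_zero b p ha (m q)) fun q q' hqq => ?_,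
    fun q => ⟨boxEigenvalue a (m q), ?_, isNeumannSolution_boxMode b p ha (m q)⟩⟩
  · obtain ⟨i, hi⟩ := Function.ne_iff.1 (he.ne hqq)
    refine inner_boxMode_eq_zero b p ha (i := i) fun heq => hi (Fin.ext ?_)
    have hc : 0 < Real.pi / (2 * a i) := div_pos hpi (mul_pos two_pos (ha i))
    rw [hfreq, hfreq, pow_left_inj₀ (by positivity) (by positivity) two_ne_zero] at heq
    exact_mod_cast mul_left_cancel₀ hc.ne' heq
  · calc boxEigenvalue a (m q) ≤ ∑ _i : Fin n, (Real.pi * r) ^ 2 :=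
          Finset.sum_le_sum fun i _ => ?_
      _ = _ := by simp
    have hai := ha i
    rw [hfreq]
    refine pow_le_pow_left₀ (by positivity) ?_ 2
    have h1 : (e q i : ℕ) ≤ ⌊r * (2 * a i)⌋₊ := by have := (e q i).2; omega
    have h2 : ((e q i : ℕ) : ℝ) ≤ r * (2 * a i) :=
      (Nat.cast_le.2 h1).trans (Nat.floor_le (by positivity))
    calc _ ≤ Real.pi / (2 * a i) * (r * (2 * a i)) :=
          mul_le_mul_of_nonneg_left h2 (by positivity)
      _ = _ := by field_simp

/-- The counting bound for the Neumann eigenvalues of a box. -/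
lemma neumannEigenvalue_openBox_le (ha : ∀ i, 0 < a i) {k : ℕ} (hk1 : 1 ≤ k) {r : ℝ} (hr : 0 < r)
    (hk : k + 1 ≤ ∏ i, (1 + ⌊r * (2 * a i)⌋₊)) :
    0 < neumannEigenvalue (openBox b p a) k ∧
      neumannEigenvalue (openBox b p a) k ≤ n * (Real.pi * r) ^ 2 := by
  obtain ⟨t₀, ht₀, hlow⟩ := exists_pos_le_of_linearIndependent b p ha
  have hmem := exists_linearIndependent_boxMode b p ha hr hk
  -- `t₀` serves twice: it makes the infimum positive and bounds the set below, as `csInf_le`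
  -- requires.
  exact ⟨ht₀.trans_le (le_csInf ⟨_, hmem⟩ fun t ht => hlow k hk1 t ht),
    csInf_le ⟨t₀, fun t ht => hlow k hk1 t ht⟩ hmem⟩

end Eigenvalues

/-! ### The main theorem -/

theorem lemma3p1 :
    ∃ c : ℝ, 0 < c ∧
      ∀ n : ℕ, 1 ≤ n →
        ∀ Ω : Set (EuclideanSpace ℝ (Fin n)), IsOrthotope Ω →
          ∀ k l : ℕ, 1 ≤ l → l ≤ k →
            ∃ (l' : ℕ) (P : Fin l' → Set (EuclideanSpace ℝ (Fin n))),
              l' ≤ l ∧ IsConvexPartition Ω P ∧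
                ∀ i, Metric.diam (P i) ≤
                  c * (n : ℝ) ^ (3 / 2 : ℝ) *
                    ((k : ℝ) / ((l : ℝ) * √(neumannEigenvalue (interior Ω) k))) := by
  have hpi := Real.pi_pos
  -- The `4` comes from `δ = 4k / (l r)`, the `π` from the frequency bound `π r`.
  refine ⟨4 * Real.pi, by positivity, fun n hn Ω ⟨b, p, a, ha, hΩ⟩ k l hl hlk => ?_⟩
  replace hΩ : Ω = closedBox b p a := hΩ
  have hk : 1 ≤ k := hl.trans hlk
  have hL : ∀ i, 0 < 2 * a i := fun i => mul_pos two_pos (ha i)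
  obtain ⟨r, hr, hlarge, hsmall⟩ := exists_scale_floor_prod hn hL hk
  -- Positivity is essential: for `μ = 0` the right-hand side of the claim would be `0`, by the
  -- convention for division by zero.
  obtain ⟨hμ0, hμ⟩ := neumannEigenvalue_openBox_le b p ha hk hr hlarge
  rw [hΩ, interior_closedBox]
  set μ := neumannEigenvalue (openBox b p a) k
  have hl' : (0 : ℝ) < l := by exact_mod_cast hl
  have hk' : (0 : ℝ) < k := by exact_mod_cast hk
  have hn' : (1 : ℝ) ≤ n := by exact_mod_cast hn
  set δ : ℝ := 2 * k / (l * (r / 2)) with hδ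
  have hδ0 : 0 < δ := by positivity
  obtain ⟨P, hP, hdiam⟩ := exists_grid_partition b p ha (fun i => ⌈2 * a i / δ⌉₊)
    (fun i => Nat.ceil_pos.2 (div_pos (hL i) hδ0)) (δ := δ)
    (fun i => by
      rw [mul_comm δ, ← div_le_iff₀ hδ0]
      exact Nat.le_ceil _) hδ0.le
  refine ⟨_, P, ceil_prod_le hL hl hlk (half_pos hr) hsmall, hP, fun i => (hdiam i).trans ?_⟩
  have hsq : √μ ≤ √n * (Real.pi * r) := by
    rw [Real.sqrt_le_left (by positivity), mul_pow, Real.sq_sqrt (by positivity)]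
    exact hμ
  have hsμ : 0 < √μ := Real.sqrt_pos.2 hμ0
  -- The argument yields the power `n`; it is weakened to `n ^ (3 / 2)` using `1 ≤ n`.
  have hpow : √n * √n ≤ (n : ℝ) ^ (3 / 2 : ℝ) := by
    rw [Real.mul_self_sqrt (by positivity)]
    calc (n : ℝ) = (n : ℝ) ^ (1 : ℝ) := (Real.rpow_one _).symm
      _ ≤ _ := Real.rpow_le_rpow_of_exponent_le hn' (by norm_num)
  have hkey : √n * √μ ≤ Real.pi * r * (n : ℝ) ^ (3 / 2 : ℝ) := by
    calc √n * √μ ≤ √n * (√n * (Real.pi * r)) :=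
          mul_le_mul_of_nonneg_left hsq (Real.sqrt_nonneg _)
      _ = (Real.pi * r) * (√n * √n) := by ring
      _ ≤ _ := mul_le_mul_of_nonneg_left hpow (by positivity)
  calc √n * δ = (√n * √μ) * (4 * k / (l * r * √μ)) := by
        rw [hδ]
        field_simp
        ring
    _ ≤ (Real.pi * r * (n : ℝ) ^ (3 / 2 : ℝ)) * (4 * k / (l * r * √μ)) :=
        mul_le_mul_of_nonneg_right hkey (by positivity)
    _ = _ := by
        field_simp
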